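/- Let $s\ge 1$ and $2\le p\le s+2$ be integers. For an explicit $S$-stage Runge–Kutta method with real coefficients $(a_{ij})_{j<i}$, $(b_i)$, one step of size $h$ for $\dot y=F(y)$ from $y$ is $$\Phi_h(y)=y+h\sum_{i=1}^{S}b_iF(g_i),\qquad g_i=y+h\sum_{j<i}a_{ij}F(g_j).$$ The method has order $s$ if, for every finite-dimensional system $\dot y=F(y)$ with $F$ of class $C^{s+1}$ near the initial point $y(0)$, the exact solution $y(\cdot)$ satisfies $\|\Phi_h(y(0))-y(h)\|=O(h^{s+1})$ as $h\downarrow 0$. Fix a method of order $s$. Then there is a constant $\tilde C>0$, depending only on $p$, $s$ and the method, with the following property. Let $d\ge 0$, let $f:\mathbb R^d\to\mathbb R$ be convex and $s+2$ times continuously differentiable, let $x^*$ be a minimizer of $f$, and let $x_0\in\mathbb R^d$. Put $$\mathcal S=\{x: f(x)-f(x^*)\le e\,(f(x_0)-f(x^*)+\|x_0-x^*\|^2)+1\},\qquad \mathcal A=\{x:\exists x'\in\mathcal S,\ \|x-x'\|\le 1\}.$$ Assume that for some $L>0$ and $M\ge 0$ and all $x\in\mathcal A$, with $\|\cdot\|$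 the operator norm of derivative tensors, $$f(x)-f(x^*)\ge \tfrac1L\|\nabla^{(i)}f(x)\|^{\frac{p}{p-i}}\quad(1\le i\le p-1),\qquad \|\nabla^{(i)}f(x)\|\le M\quad(p\le i\le s+2).$$ For $y=[v;x;t]\in\mathbb R^{2d+1}$ let $$F(y)=\Big[-\tfrac{2p+1}{t}v-p^2t^{p-2}\nabla f(x);\ v;\ 1\Big],\qquad \mathcal E(y)=\tfrac{t^2}{4p^2}\|v\|^2+\Big\|x+\tfrac{t}{2p}v-x^*\Big\|^2+t^p\,(f(x)-f(x^*)).$$ Let $N\ge 1$ be an integer, let $h>0$, let $y_0=[0;x_0;1]$ and $y_{k+1}=\Phi_h(y_k)$ for this $F$, and write $E_k=\mathcal E(y_k)$. If $$h\le \tilde C\,\frac{N^{-1/(s+1)}}{(L+M+1)(eE_0+1)},$$ then $$E_k\le\Big(1+\frac1N\Big)^kE_0+\frac kN\qquad\text{for all }k=0,1,\dots,N,$$ and in particular $E_N\le eE_0+1$. -/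

import Mathlib

open Filter Topology Asymptotics

noncomputable section

/-- The coefficients of an explicit `S`-stage Runge-Kutta method. Only the entries `a i j` with
`j < i` are used. -/
structure RungeKutta (S : ℕ) where
  a : Fin S → Fin S → ℝ
  b : Fin S → ℝ

namespace RungeKutta

variable {S : ℕ} {V : Type*} [AddCommGroup V] [Module ℝ V]

/-- The evaluation points `g i = y + h ∑_{j < i} a i j F (g j)` for the autonomous system
`y' = F y`, the current point `y` and the step size `h`. -/
def stage (rk : RungeKutta S) (F : V → V) (h : ℝ) (y : V) (i : Fin S) : V :=
  y + h • ∑ j : {j : Fin S // j < i}, rk.a i j.1 • F (stage rk F h y j.1)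
termination_by i.val
decreasing_by exact j.2

theorem stage_eq (rk : RungeKutta S) (F : V → V) (h : ℝ) (y : V) (i : Fin S) :
    rk.stage F h y i = y + h • ∑ j ∈ Finset.Iio i, rk.a i j • F (rk.stage F h y j) := by
  rw [stage]
  congr 2
  exact (Finset.sum_subtype (Finset.Iio i) (fun j => Finset.mem_Iio)
    (fun j => rk.a i j • F (rk.stage F h y j))).symm

/-- One step `Φ_h(y) = y + h ∑ i, b i F (g i)` of the method. -/
def step (rk : RungeKutta S) (F : V → V) (h : ℝ) (y : V) : V :=
  y + h • ∑ i, rk.b i • F (rk.stage F h y i)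

/-- The method has order (at least) `s`: for every finite-dimensional autonomous system `y' = F y`
with `F` of class `C^{s+1}` near the initial point, one step of size `h` differs from the exact
solution at time `h` by `O(h^{s+1})` as `h → 0`. -/
def HasOrder (rk : RungeKutta S) (s : ℕ) : Prop :=
  ∀ (W : Type) [NormedAddCommGroup W] [NormedSpace ℝ W] [FiniteDimensional ℝ W]
    (F : W → W) (φ : ℝ → W), ContDiffAt ℝ (s + 1) F (φ 0) →
    (∀ᶠ t in 𝓝 (0 : ℝ), HasDerivAt φ (F (φ t)) t) →
    (fun h : ℝ => rk.step F h (φ 0) - φ h) =O[𝓝[>] 0] fun h : ℝ => h ^ (s + 1)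

end RungeKutta

/-- The state space of triples `y = [v; x; t]` with `v, x ∈ ℝ^d` and `t ∈ ℝ`. -/
abbrev PhaseState (d : ℕ) : Type :=
  EuclideanSpace ℝ (Fin d) × EuclideanSpace ℝ (Fin d) × ℝ

/-- The vector field `F([v; x; t]) = [-((2p+1)/t) v - p² t^{p-2} ∇f(x); v; 1]`, that is, the second
order equation `x'' + ((2p+1)/t) x' + p² t^{p-2} ∇f(x) = 0` as a first order autonomous system. -/
def dynamics {d : ℕ} (f : EuclideanSpace ℝ (Fin d) → ℝ) (p : ℕ) (y : PhaseState d) :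
    PhaseState d :=
  (-((2 * (p : ℝ) + 1) / y.2.2) • y.1 - ((p : ℝ) ^ 2 * y.2.2 ^ (p - 2)) • gradient f y.2.1,
    y.1, 1)

/-- The Lyapunov function
`𝓔([v; x; t]) = t²/(4p²) ‖v‖² + ‖x + t/(2p) v - x*‖² + t^p (f(x) - f(x*))`. -/
def lyapunov {d : ℕ} (f : EuclideanSpace ℝ (Fin d) → ℝ) (xstar : EuclideanSpace ℝ (Fin d))
    (p : ℕ) (y : PhaseState d) : ℝ :=
  y.2.2 ^ 2 / (4 * (p : ℝ) ^ 2) * ‖y.1‖ ^ 2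
    + ‖y.2.1 + (y.2.2 / (2 * (p : ℝ))) • y.1 - xstar‖ ^ 2
    + y.2.2 ^ p * (f y.2.1 - f xstar)

/-- The sublevel set `𝓢 = {x | f(x) - f(x*) ≤ e (f(x₀) - f(x*) + ‖x₀ - x*‖²) + 1}`. -/
def sublevelS {d : ℕ} (f : EuclideanSpace ℝ (Fin d) → ℝ)
    (xstar x0 : EuclideanSpace ℝ (Fin d)) : Set (EuclideanSpace ℝ (Fin d)) :=
  {x | f x - f xstar ≤ Real.exp 1 * (f x0 - f xstar + ‖x0 - xstar‖ ^ 2) + 1}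

/-- The set `𝓐` of points at distance at most `1` from some point of `𝓢`. -/
def neighborhoodA {d : ℕ} (f : EuclideanSpace ℝ (Fin d) → ℝ)
    (xstar x0 : EuclideanSpace ℝ (Fin d)) : Set (EuclideanSpace ℝ (Fin d)) :=
  {x | ∃ x' ∈ sublevelS f xstar x0, ‖x - x'‖ ≤ 1}

/-- Local flatness on `A`: `f(x) - f(x*) ≥ (1/L) ‖∇^i f(x)‖^{p/(p-i)}` for `1 ≤ i ≤ p - 1`, with
the operator norm of the derivative tensors. -/
def GrowthCondition {d : ℕ} (f : EuclideanSpace ℝ (Fin d) → ℝ)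
    (xstar : EuclideanSpace ℝ (Fin d)) (A : Set (EuclideanSpace ℝ (Fin d)))
    (p : ℕ) (L : ℝ) : Prop :=
  ∀ x ∈ A, ∀ i : ℕ, 1 ≤ i → i < p →
    (1 / L) * ‖iteratedFDeriv ℝ i f x‖ ^ ((p : ℝ) / ((p : ℝ) - (i : ℝ))) ≤ f x - f xstar

/-- `f` is `s + 2` times continuously differentiable and `‖∇^i f(x)‖ ≤ M` on `A` for
`p ≤ i ≤ s + 2`. -/
def DerivativeBound {d : ℕ} (f : EuclideanSpace ℝ (Fin d) → ℝ)
    (A : Set (EuclideanSpace ℝ (Fin d))) (p s : ℕ) (M : ℝ) : Prop :=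
  ContDiff ℝ (s + 2) f ∧
    ∀ x ∈ A, ∀ i : ℕ, p ≤ i → i ≤ s + 2 → ‖iteratedFDeriv ℝ i f x‖ ≤ M

/-- The iterates `y_{k+1} = Φ_h(y_k)` of the method applied to the dynamics, with
`y_0 = [0; x₀; 1]`. -/
def rkIterate {S d : ℕ} (rk : RungeKutta S) (f : EuclideanSpace ℝ (Fin d) → ℝ) (p : ℕ)
    (x0 : EuclideanSpace ℝ (Fin d)) (h : ℝ) : ℕ → PhaseState d
  | 0 => (0, x0, 1)
  | k + 1 => rk.step (dynamics f p) h (rkIterate rk f p x0 h k)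

end

/-! The energy `lyapunov` does not increase along exact solutions, so a Runge–Kutta step can raise
it only through its local error. The point is to bound that error uniformly in `f`, the dimension
and the current time.

`HasOrder` only gives an O(h^(s+1)) whose constant depends on the vector field. It does force the
degree-s Taylor polynomial in h of (numerical step − exact flow) to vanish. The error is then
controlled by the derivative of order s+1 in h, and this is at most a constant times Q^(s+1) when
the field and its derivatives up to order s+1 are bounded by Q near the starting point
(`RungeKutta.HasOrder.exists_local_error`).

To obtain a good Q at time τ, put A = L + M + 1, B = E + 1 and pass to the coordinates w = τv, ξ =
τAx. Runge–Kutta steps commute with linear maps, so nothing is lost. The growth condition gives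
τ^p‖∇^i f‖ ≤ τ^i·A·(τ^p(f − f*) + 1), and the last factor changes by at most e over the distance
1/(τA). Hence Q = K·A·B with K depending only on p and s (`exists_scaledDynamics_bound`), and all
powers of τ cancel.

In these coordinates the energy is Lipschitz with constant O(B) (`lyapunov_sub_le`), which gives
E_{k+1} + 1 ≤ (E_k + 1)(1 + C(hAB)^(s+1)). The assumed step size makes the factor at most 1 +
1/(2N), and induction over k ≤ N closes the argument. -/

/-! ### Derivatives of curves composed with a vector field. -/

open scoped Nat in
/-- Derivatives of a composition `F ∘ u` with a curve whose derivatives grow geometrically. -/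
theorem norm_iteratedDerivWithin_comp_curve_le {W : Type*} [NormedAddCommGroup W]
    [NormedSpace ℝ W] {F : W → W} {U : Set W} (hU : IsOpen U) {n : ℕ} {Q D : ℝ}
    (hF : ContDiffOn ℝ n F U)
    (hFQ : ∀ z ∈ U, ∀ i ≤ n, ‖iteratedFDeriv ℝ i F z‖ ≤ Q)
    {u : ℝ → W} {s : Set ℝ} (hs : UniqueDiffOn ℝ s) (hu : ContDiffOn ℝ n u s)
    (hmap : Set.MapsTo u s U) {k : ℕ} (hk : k ≤ n) {t : ℝ} (ht : t ∈ s)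
    (hD : ∀ i, 1 ≤ i → i ≤ k → ‖iteratedDerivWithin i u s t‖ ≤ D ^ i) :
    ‖iteratedDerivWithin k (F ∘ u) s t‖ ≤ k ! * Q * D ^ k := by
  rw [← norm_iteratedFDerivWithin_eq_norm_iteratedDerivWithin]
  refine norm_iteratedFDerivWithin_comp_le hF hu (by exact_mod_cast hk) hU.uniqueDiffOn hs hmap ht
    (fun i hi => ?_) (fun i h1 hi => ?_)
  · rw [iteratedFDerivWithin_of_isOpen i hU (hmap ht)]
    exact hFQ _ (hmap ht) i (hi.trans hk)
  · rw [norm_iteratedFDerivWithin_eq_norm_iteratedDerivWithin]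
    exact hD i h1 hi

open scoped Nat in
/-- The derivatives of an integral curve of a vector field with derivatives bounded by `Q`. -/
theorem norm_iteratedDerivWithin_integralCurve_le {W : Type*} [NormedAddCommGroup W]
    [NormedSpace ℝ W] {F : W → W} {U : Set W} (hU : IsOpen U) {n : ℕ} {Q : ℝ} (hQ : 0 ≤ Q)
    (hF : ContDiffOn ℝ n F U)
    (hFQ : ∀ z ∈ U, ∀ i ≤ n, ‖iteratedFDeriv ℝ i F z‖ ≤ Q)
    {γ : ℝ → W} {s : Set ℝ} (hs : UniqueDiffOn ℝ s) (hγn : ContDiffOn ℝ n γ s)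
    (hmap : Set.MapsTo γ s U)
    (hγ : ∀ t ∈ s, HasDerivWithinAt γ (F (γ t)) s t) {k : ℕ} (hk1 : 1 ≤ k) (hk : k ≤ n)
    {t : ℝ} (ht : t ∈ s) :
    ‖iteratedDerivWithin k γ s t‖ ≤ (n ! * Q) ^ k := by
  induction k using Nat.strong_induction_on with
  | _ k ih =>
    obtain ⟨m, rfl⟩ := Nat.exists_eq_succ_of_ne_zero (Nat.one_le_iff_ne_zero.1 hk1)
    -- The derivative of order m+1 of γ is that of order m of F ∘ γ, which involves only lower
    -- derivatives of γ; each order costs one factor n!·Q.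
    have hd : Set.EqOn (derivWithin γ s) (F ∘ γ) s :=
      fun x hx => (hγ x hx).derivWithin (hs x hx)
    rw [Nat.succ_eq_add_one, iteratedDerivWithin_succ', iteratedDerivWithin_congr hd ht]
    have h1 := norm_iteratedDerivWithin_comp_curve_le hU hF hFQ hs hγn hmap (k := m) (by omega) ht
      (D := n ! * Q) (fun i hi1 hi => ih i (by omega) hi1 (by omega))
    refine h1.trans ?_
    rw [pow_succ']
    have : (m ! : ℝ) ≤ n ! := by exact_mod_cast Nat.factorial_le (by omega)
    gcongr

open scoped Nat in
/-- The derivatives of `h ↦ h F(u(h))` on a short interval. -/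
theorem norm_iteratedDerivWithin_smul_comp_le {W : Type*} [NormedAddCommGroup W]
    [NormedSpace ℝ W] {F : W → W} {U : Set W} (hU : IsOpen U) {n : ℕ} {Q c b : ℝ} (hQ : 0 < Q)
    (hc : 1 ≤ c) (hb : 0 < b) (hbQ : b * Q ≤ 1)
    (hF : ContDiffOn ℝ n F U)
    (hFQ : ∀ z ∈ U, ∀ i ≤ n, ‖iteratedFDeriv ℝ i F z‖ ≤ Q)
    {u : ℝ → W} (hu : ContDiffOn ℝ n u (Set.Icc 0 b))
    (hmap : Set.MapsTo u (Set.Icc 0 b) U)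
    (hD : ∀ t ∈ Set.Icc 0 b, ∀ i, 1 ≤ i → i ≤ n →
      ‖iteratedDerivWithin i u (Set.Icc 0 b) t‖ ≤ (c * Q) ^ i) :
    ∀ t ∈ Set.Icc 0 b, ∀ i, i ≤ n →
      ‖iteratedDerivWithin i (fun h => h • F (u h)) (Set.Icc 0 b) t‖ ≤
        2 ^ n * n ! * (c * Q) ^ i := by
  intro t ht k hk
  have hs := uniqueDiffOn_Icc hb
  have h1 := norm_iteratedFDerivWithin_smul_le (𝕜 := ℝ) (f := fun h : ℝ => h)
    (g := F ∘ u) (N := n) (s := Set.Icc 0 b) contDiffOn_id (hF.comp hu hmap) hs ht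
    (n := k) (by exact_mod_cast hk)
  rw [← norm_iteratedFDerivWithin_eq_norm_iteratedDerivWithin]
  refine h1.trans ?_
  have hcQ : Q ≤ c * Q := le_mul_of_one_le_left hQ.le hc
  -- The bound Q^(i-1), written so that i = 0 is covered: there it says t ≤ 1/Q, which is `hbQ`.
  have hid : ∀ i, ‖iteratedFDerivWithin ℝ i (fun h : ℝ => h) (Set.Icc 0 b) t‖ ≤ Q ^ i / Q := by
    intro i
    rw [norm_iteratedFDerivWithin_eq_norm_iteratedDerivWithin]
    change ‖iteratedDerivWithin i id (Set.Icc 0 b) t‖ ≤ _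
    rw [iteratedDerivWithin_id ht hs]
    split_ifs with h0 h1
    · subst h0
      rw [Real.norm_of_nonneg ht.1, le_div_iff₀ hQ]
      simpa using (mul_le_mul_of_nonneg_right ht.2 hQ.le).trans hbQ
    · subst h1
      simp [hQ.ne']
    · simp; positivity
  calc _ ≤ ∑ i ∈ Finset.range (k + 1), (k.choose i : ℝ) * (n ! * (c * Q) ^ k) := by
        refine Finset.sum_le_sum fun i hi => ?_
        rw [mul_assoc]
        have hik : i ≤ k := by simpa [Nat.lt_succ_iff] using hi
        refine mul_le_mul_of_nonneg_left ?_ (by positivity)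
        have h2 : ‖iteratedFDerivWithin ℝ (k - i) (F ∘ u) (Set.Icc 0 b) t‖ ≤
            n ! * Q * (c * Q) ^ (k - i) := by
          rw [norm_iteratedFDerivWithin_eq_norm_iteratedDerivWithin]
          refine (norm_iteratedDerivWithin_comp_curve_le hU hF hFQ hs hu hmap (by omega) ht
            (D := c * Q) (fun j hj1 hj => hD t ht j hj1 (by omega))).trans ?_
          have : ((k - i) ! : ℝ) ≤ n ! := by exact_mod_cast Nat.factorial_le (by omega)
          gcongr
        calc _ ≤ (Q ^ i / Q) * (n ! * Q * (c * Q) ^ (k - i)) := by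
              gcongr
              exact hid i
          _ = n ! * (Q ^ i * (c * Q) ^ (k - i)) := by field_simp
          _ ≤ n ! * ((c * Q) ^ i * (c * Q) ^ (k - i)) := by gcongr
          _ = _ := by rw [← pow_add, Nat.add_sub_cancel' hik]
    _ = 2 ^ k * (n ! * (c * Q) ^ k) := by
        rw [← Finset.sum_mul]
        congr 1
        exact_mod_cast Nat.sum_range_choose k
    _ ≤ _ := by
        rw [mul_assoc]
        gcongr
        norm_num

/-! ### From vanishing order to a quantitative Taylor bound. -/

/-- A polynomial with vector coefficients of degree `< n` that is `O(x ^ n)` at `0` vanishes. -/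
theorem coeff_eq_zero_of_isBigO {W : Type*} [NormedAddCommGroup W] [NormedSpace ℝ W] (n : ℕ)
    (c : ℕ → W)
    (h : (fun x : ℝ => ∑ k ∈ Finset.range n, x ^ k • c k) =O[𝓝[>] 0] fun x : ℝ => x ^ n) :
    ∀ k < n, c k = 0 := by
  induction n generalizing c with
  | zero => intro k hk; omega
  | succ n ih =>
    have hcont : Continuous fun x : ℝ => ∑ k ∈ Finset.range (n + 1), x ^ k • c k := by fun_prop
    have h0 : c 0 = 0 := by
      have t1 : Tendsto (fun x : ℝ => ∑ k ∈ Finset.range (n + 1), x ^ k • c k) (𝓝[>] 0)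
          (𝓝 (c 0)) := by
        have := (hcont.tendsto 0).mono_left (nhdsWithin_le_nhds (s := Set.Ioi 0))
        simpa [Finset.sum_range_succ'] using this
      have t2 : Tendsto (fun x : ℝ => x ^ (n + 1)) (𝓝[>] 0) (𝓝 0) := by
        have := ((continuous_pow (M := ℝ) (n + 1)).tendsto 0).mono_left
          (nhdsWithin_le_nhds (s := Set.Ioi 0))
        simpa using this
      exact tendsto_nhds_unique t1 (h.trans_tendsto t2)
    have hq : (fun x : ℝ => ∑ k ∈ Finset.range n, x ^ k • c (k + 1)) =O[𝓝[>] 0]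
        fun x : ℝ => x ^ n := by
      obtain ⟨K, hK⟩ := h.bound
      refine IsBigO.of_bound K ?_
      filter_upwards [hK, self_mem_nhdsWithin] with x hx hx0
      have hx0 : 0 < x := hx0
      have e : ∑ k ∈ Finset.range (n + 1), x ^ k • c k =
          x • ∑ k ∈ Finset.range n, x ^ k • c (k + 1) := by
        rw [Finset.sum_range_succ', h0, Finset.smul_sum]
        simp [smul_smul, pow_succ']
      rw [e, norm_smul, pow_succ', norm_mul] at hx
      have hn : 0 < ‖x‖ := by simpa using hx0.ne'
      nlinarith
    intro k hk
    rcases k with _ | k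
    · exact h0
    · exact ih (fun k => c (k + 1)) hq k (by omega)

open scoped Nat in
/-- A curve which vanishes to order `s + 1` at `0` is controlled by its derivative of that order. -/
theorem norm_le_of_isBigO_pow {W : Type*} [NormedAddCommGroup W] [NormedSpace ℝ W] {s : ℕ}
    {D : ℝ → W} {b K : ℝ} (hb : 0 < b) (hD : ContDiffOn ℝ (s + 1) D (Set.Icc 0 b))
    (hO : D =O[𝓝[>] 0] fun x : ℝ => x ^ (s + 1))
    (hK : ∀ t ∈ Set.Icc 0 b, ‖iteratedDerivWithin (s + 1) D (Set.Icc 0 b) t‖ ≤ K) :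
    ‖D b‖ ≤ K * b ^ (s + 1) := by
  have hT := fun x hx => taylor_mean_remainder_bound hb.le hD (x := x) hx hK
  have hmem : ∀ᶠ x in 𝓝[>] (0 : ℝ), x ∈ Set.Icc 0 b :=
    mem_of_superset (Ioc_mem_nhdsGT hb) Set.Ioc_subset_Icc_self
  -- D and its Taylor remainder are both O(x^(s+1)), hence so is the Taylor polynomial, whose
  -- coefficients must then vanish.
  have hTO : (fun x => taylorWithinEval D s (Set.Icc 0 b) 0 x) =O[𝓝[>] 0]
      fun x : ℝ => x ^ (s + 1) := by
    have : (fun x => D x - taylorWithinEval D s (Set.Icc 0 b) 0 x) =O[𝓝[>] 0]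
        fun x : ℝ => x ^ (s + 1) := by
      refine IsBigO.of_bound (K / s !) ?_
      filter_upwards [hmem] with x hx
      refine (hT x hx).trans (le_of_eq ?_)
      rw [sub_zero, Real.norm_of_nonneg (pow_nonneg hx.1 _)]
      ring
    simpa using hO.sub this
  have hz := coeff_eq_zero_of_isBigO (s + 1)
    (fun k => (k ! : ℝ)⁻¹ • iteratedDerivWithin k D (Set.Icc 0 b) 0) (by
      refine hTO.congr_left fun x => ?_
      rw [taylor_within_apply]
      refine Finset.sum_congr rfl fun k _ => ?_
      rw [sub_zero, smul_smul, mul_comm])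
  have hTb : taylorWithinEval D s (Set.Icc 0 b) 0 b = 0 := by
    rw [taylor_within_apply]
    refine Finset.sum_eq_zero fun k hk => ?_
    rw [mul_comm, ← smul_smul]
    have := hz k (Finset.mem_range.1 hk)
    rw [this, smul_zero]
  have hKpos : 0 ≤ K := (norm_nonneg _).trans (hK 0 ⟨le_rfl, hb.le⟩)
  have := hT b ⟨hb.le, le_rfl⟩
  rw [hTb, sub_zero, sub_zero] at this
  refine this.trans (div_le_self (by positivity) ?_)
  exact_mod_cast Nat.factorial_pos s

/-! ### Existence and confinement of integral curves. -/

/-- Integral curves of a vector field bounded by `Q` in a ball stay there for a time `r / (2 Q)`. -/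
theorem exists_integralCurve_mem_ball {W : Type*} [NormedAddCommGroup W] [NormedSpace ℝ W]
    [CompleteSpace W] {F : W → W} {y : W} {r Q T : ℝ} (hr : 0 < r) (hQ : 0 ≤ Q) (hT : 0 ≤ T)
    (hTQ : Q * T ≤ r / 2) (hF : ∀ z ∈ Metric.ball y r, DifferentiableAt ℝ F z)
    (hF0 : ∀ z ∈ Metric.ball y r, ‖F z‖ ≤ Q) (hF1 : ∀ z ∈ Metric.ball y r, ‖fderiv ℝ F z‖ ≤ Q) :
    ∃ γ : ℝ → W, γ 0 = y ∧ ∀ t ∈ Set.Icc (-T) T, γ t ∈ Metric.ball y r ∧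
      HasDerivWithinAt γ (F (γ t)) (Set.Icc (-T) T) t := by
  have hsub : Metric.closedBall y (r / 2) ⊆ Metric.ball y r :=
    Metric.closedBall_subset_ball (half_lt_self hr)
  have h0 : (0 : ℝ) ∈ Set.Icc (-T) T := ⟨by linarith, hT⟩
  lift Q to NNReal using hQ
  obtain ⟨ρ, hρ⟩ : ∃ ρ : NNReal, (ρ : ℝ) = r / 2 := ⟨Real.toNNReal (r / 2), by
    rw [Real.coe_toNNReal _ (by positivity)]⟩
  rw [← hρ] at hsub hTQ
  have hlip : LipschitzOnWith Q F (Metric.closedBall y ρ) :=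
    (convex_closedBall y ρ).lipschitzOnWith_of_nnnorm_fderiv_le
      (fun z hz => hF z (hsub hz)) (fun z hz => hF1 z (hsub hz))
  have hPL : IsPicardLindelof (fun _ => F) (⟨0, h0⟩ : Set.Icc (-T) T) y
      ρ 0 Q Q :=
    IsPicardLindelof.of_time_independent (fun z hz => hF0 z (hsub hz)) hlip (by simpa using hTQ)
  have hy : y ∈ Metric.closedBall y ((0 : NNReal) : ℝ) := by simp
  -- The Picard fixed point itself is used because, as an element of `ODE.FunSpace`, it comes with
  -- confinement to the closed ball.
  obtain ⟨α, hα⟩ := ODE.FunSpace.exists_isFixedPt_next hPL hy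
  have hball : ∀ t, α.compProj t ∈ Metric.closedBall y ρ := fun t =>
    α.compProj_mem_closedBall hPL.mul_max_le
  have hpic : ∀ t ∈ Set.Icc (-T) T, α.compProj t = ODE.picard (fun _ => F) 0 y α.compProj t := by
    intro t ht
    have := ODE.FunSpace.next_apply hPL hy α (t := ⟨t, ht⟩)
    rw [hα] at this
    rw [ODE.FunSpace.compProj_of_mem ht, this]
  refine ⟨α.compProj, ?_, fun t ht => ⟨hsub (hball t), ?_⟩⟩
  · rw [hpic 0 h0]; simp
  · refine (ODE.hasDerivWithinAt_picard_Icc (u := Metric.ball y r) (f := fun _ => F) h0 ?_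
      α.continuous_compProj.continuousOn (fun t _ => hsub (hball t)) y ht).congr hpic (hpic t ht)
    have : ContinuousOn F (Metric.ball y r) := fun z hz =>
      (hF z hz).continuousAt.continuousWithinAt
    exact this.comp continuousOn_snd (fun z hz => hz.2)

/-! ### Stages and uniform local error of a Runge–Kutta method. -/

open scoped Nat in
/-- Bounds on one stage of a Runge-Kutta method as a function of the step size, in terms of the
previous stages. -/
theorem RungeKutta.stage_curve_bound {W ι : Type*} [NormedAddCommGroup W] [NormedSpace ℝ W]
    {F : W → W} {y : W} {r : ℝ} {n : ℕ} {Q c b B : ℝ}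
    (hQ : 0 < Q) (hc : 1 ≤ c) (hb : 0 < b) (hbQ : b * Q ≤ 1)
    (hF : ContDiffOn ℝ n F (Metric.ball y r))
    (hFQ : ∀ z ∈ Metric.ball y r, ∀ i ≤ n, ‖iteratedFDeriv ℝ i F z‖ ≤ Q)
    {J : Finset ι} {β : ι → ℝ} (hB : ∑ j ∈ J, |β j| ≤ B) (hBr : b * Q * B < r)
    {g : ι → ℝ → W} (hg : ∀ j ∈ J, ContDiffOn ℝ n (g j) (Set.Icc 0 b))
    (hmap : ∀ j ∈ J, Set.MapsTo (g j) (Set.Icc 0 b) (Metric.ball y r))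
    (hD : ∀ j ∈ J, ∀ t ∈ Set.Icc 0 b, ∀ i, 1 ≤ i → i ≤ n →
      ‖iteratedDerivWithin i (g j) (Set.Icc 0 b) t‖ ≤ (c * Q) ^ i) :
    Set.MapsTo (fun h : ℝ => y + h • ∑ j ∈ J, β j • F (g j h)) (Set.Icc 0 b) (Metric.ball y r) ∧
    ContDiffOn ℝ n (fun h : ℝ => y + h • ∑ j ∈ J, β j • F (g j h)) (Set.Icc 0 b) ∧
    ∀ t ∈ Set.Icc 0 b, ∀ i, 1 ≤ i → i ≤ n →
      ‖iteratedDerivWithin i (fun h : ℝ => y + h • ∑ j ∈ J, β j • F (g j h)) (Set.Icc 0 b) t‖ ≤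
        2 ^ n * n ! * B * (c * Q) ^ i := by
  have hs := uniqueDiffOn_Icc hb
  have heq : (fun h : ℝ => y + h • ∑ j ∈ J, β j • F (g j h)) =
      fun h : ℝ => y + ∑ j ∈ J, β j • (h • F (g j h)) := by
    funext h
    simp only [Finset.smul_sum]
    congr 1
    exact Finset.sum_congr rfl fun j _ => smul_comm _ _ _
  have hsm : ∀ j ∈ J, ContDiffOn ℝ n (fun h : ℝ => h • F (g j h)) (Set.Icc 0 b) := fun j hj =>
    contDiffOn_id.smul (hF.comp (hg j hj) (hmap j hj))
  have hB0 : 0 ≤ B := (Finset.sum_nonneg fun j _ => abs_nonneg _).trans hB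
  refine ⟨fun t ht => ?_, ?_, fun t ht i hi1 hi => ?_⟩
  · rw [Metric.mem_ball, dist_eq_norm, add_sub_cancel_left, norm_smul, Real.norm_of_nonneg ht.1]
    calc t * ‖∑ j ∈ J, β j • F (g j t)‖ ≤ t * (Q * B) := by
          refine mul_le_mul_of_nonneg_left ?_ ht.1
          calc _ ≤ ∑ j ∈ J, |β j| * Q := by
                refine norm_sum_le_of_le J fun j hj => ?_
                rw [norm_smul, Real.norm_eq_abs]
                have := hFQ _ (hmap j hj ht) 0 (by omega)
                rw [norm_iteratedFDeriv_zero] at this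
                gcongr
            _ ≤ Q * B := by
                rw [← Finset.sum_mul, mul_comm]
                gcongr
      _ ≤ b * (Q * B) := by
          have := ht.2
          gcongr
      _ < r := by linarith
  · rw [heq]
    exact contDiffOn_const.add (ContDiffOn.sum fun j hj => contDiffOn_const.smul (hsm j hj))
  · rw [heq, iteratedDerivWithin_const_add (by omega),
      iteratedDerivWithin_fun_sum ht hs (fun j hj => by
        have := (hsm j hj t ht).of_le (m := i) (by exact_mod_cast hi)
        exact contDiffWithinAt_const.smul this)]
    calc _ ≤ ∑ j ∈ J, |β j| * (2 ^ n * n ! * (c * Q) ^ i) := by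
          refine norm_sum_le_of_le J fun j hj => ?_
          rw [iteratedDerivWithin_fun_const_smul_field, norm_smul, Real.norm_eq_abs]
          gcongr
          exact norm_iteratedDerivWithin_smul_comp_le Metric.isOpen_ball hQ hc hb hbQ hF hFQ
            (hg j hj) (hmap j hj) (hD j hj) t ht i hi
      _ ≤ B * (2 ^ n * n ! * (c * Q) ^ i) := by
          rw [← Finset.sum_mul]
          have : 0 ≤ c * Q := by positivity
          gcongr
      _ = _ := by ring

namespace RungeKutta

open scoped Nat in
/-- The stages of a Runge-Kutta method as functions of the step size. -/
theorem stage_bound {S : ℕ} (rk : RungeKutta S) {W : Type*} [NormedAddCommGroup W]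
    [NormedSpace ℝ W] {F : W → W} {y : W} {r : ℝ} {n : ℕ} {Q b A α : ℝ}
    (hQ : 0 < Q) (hb : 0 < b) (hbQ : b * Q ≤ 1)
    (hF : ContDiffOn ℝ n F (Metric.ball y r))
    (hFQ : ∀ z ∈ Metric.ball y r, ∀ i ≤ n, ‖iteratedFDeriv ℝ i F z‖ ≤ Q)
    (hA : ∀ i, ∑ j ∈ Finset.Iio i, |rk.a i j| ≤ A) (hBr : b * Q * A < r)
    (hα1 : 1 ≤ α) (hα : 2 ^ n * n ! * A ≤ α) (i : Fin S) :
    ContDiffOn ℝ n (fun h => rk.stage F h y i) (Set.Icc 0 b) ∧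
    Set.MapsTo (fun h => rk.stage F h y i) (Set.Icc 0 b) (Metric.ball y r) ∧
    ∀ t ∈ Set.Icc 0 b, ∀ k, 1 ≤ k → k ≤ n →
      ‖iteratedDerivWithin k (fun h => rk.stage F h y i) (Set.Icc 0 b) t‖ ≤
        (α ^ (i.val + 1) * Q) ^ k := by
  induction i using WellFoundedLT.induction with
  | ind i ih =>
    have hD : ∀ j ∈ Finset.Iio i, ∀ t ∈ Set.Icc 0 b, ∀ k, 1 ≤ k → k ≤ n →
        ‖iteratedDerivWithin k (fun h => rk.stage F h y j) (Set.Icc 0 b) t‖ ≤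
          (α ^ i.val * Q) ^ k := by
      intro j hj t ht k hk1 hk
      have hji : j < i := Finset.mem_Iio.1 hj
      -- Every stage costs one factor α; j < i gives the exponent j + 1 ≤ i.
      refine ((ih j hji).2.2 t ht k hk1 hk).trans ?_
      gcongr
      exact hji
    have key := stage_curve_bound (F := F) (y := y) (r := r) hQ (one_le_pow₀ hα1) hb hbQ hF hFQ
      (hA i) hBr (g := fun j h => rk.stage F h y j)
      (fun j hj => (ih j (Finset.mem_Iio.1 hj)).1) (fun j hj => (ih j (Finset.mem_Iio.1 hj)).2.1) hD
    simp only [← stage_eq] at key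
    refine ⟨key.2.1, key.1, fun t ht k hk1 hk => (key.2.2 t ht k hk1 hk).trans ?_⟩
    have hα0 : 0 ≤ α := zero_le_one.trans hα1
    -- Since k ≥ 1, the prefactor is at most α ≤ α^k and is absorbed into the base.
    calc 2 ^ n * n ! * A * (α ^ i.val * Q) ^ k ≤ α ^ k * (α ^ i.val * Q) ^ k := by
          gcongr
          exact hα.trans (le_self_pow₀ hα1 (by omega))
      _ = _ := by rw [← mul_pow]; ring

open scoped Nat in
/-- The local error of a Runge-Kutta method of order `s`, uniformly over all vector fields with
derivatives bounded by `Q` up to order `s + 1` in a ball of radius `1 / 2`. -/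
theorem HasOrder.exists_local_error {S s : ℕ} {rk : RungeKutta S} (hrk : rk.HasOrder s) :
    ∃ c > 0, ∃ C > 0, ∀ (W : Type) [NormedAddCommGroup W] [NormedSpace ℝ W]
      [FiniteDimensional ℝ W] (F : W → W) (y : W) (Q : ℝ), 0 < Q →
      (∀ z ∈ Metric.ball y (1 / 2), ContDiffAt ℝ (s + 1) F z) →
      (∀ z ∈ Metric.ball y (1 / 2), ∀ i ≤ s + 1, ‖iteratedFDeriv ℝ i F z‖ ≤ Q) →
      ∀ h : ℝ, 0 < h → h * Q ≤ c →
        rk.step F h y ∈ Metric.ball y (1 / 2) ∧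
        ∃ γ : ℝ → W, γ 0 = y ∧
          (∀ t ∈ Set.Icc 0 h, γ t ∈ Metric.ball y (1 / 2) ∧ HasDerivAt γ (F (γ t)) t) ∧
          ‖rk.step F h y - γ h‖ ≤ C * (h * Q) ^ (s + 1) := by
  set n := s + 1 with hn
  set A : ℝ := ∑ i, ∑ j, |rk.a i j| with hAdef
  set B : ℝ := ∑ i, |rk.b i| with hBdef
  set α : ℝ := 1 + 2 ^ n * n ! * A with hαdef
  have hA0 : 0 ≤ A := Finset.sum_nonneg fun i _ => Finset.sum_nonneg fun j _ => abs_nonneg _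
  have hB0 : 0 ≤ B := Finset.sum_nonneg fun i _ => abs_nonneg _
  have hα1 : 1 ≤ α := by
    have : 0 ≤ 2 ^ n * n ! * A := by positivity
    linarith
  have hAi : ∀ i, ∑ j ∈ Finset.Iio i, |rk.a i j| ≤ A := fun i =>
    (Finset.sum_le_sum_of_subset_of_nonneg (Finset.subset_univ _)
      fun j _ _ => abs_nonneg _).trans
      (Finset.single_le_sum (f := fun i => ∑ j, |rk.a i j|)
        (fun i _ => Finset.sum_nonneg fun j _ => abs_nonneg _) (Finset.mem_univ i))
  -- The bounds on the n-th derivatives of the numerical step and of the exact flow, each divided by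
  -- Q^n.
  set C : ℝ := 2 ^ n * n ! * B * (α ^ S) ^ n + (n ! : ℝ) ^ n with hCdef
  -- Small enough that stages and step move by less than 1/2 and that the flow over time 2b moves by
  -- at most 1/4.
  refine ⟨1 / (8 * (1 + A + B)), by positivity, C, by positivity, ?_⟩
  intro W _ _ _ F y Q hQ hF hFQ b hb hbc
  have hbc' : b * Q * (8 * (1 + A + B)) ≤ 1 := by
    rwa [le_div_iff₀ (by positivity)] at hbc
  have hbQ0 : 0 < b * Q := by positivity
  have hbA : b * Q * A < 1 / 2 := by nlinarith
  have hbB : b * Q * B < 1 / 2 := by nlinarith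
  have hb8 : b * Q ≤ 1 / 8 := by nlinarith
  have hbQ : b * Q ≤ 1 := by linarith
  have hU : IsOpen (Metric.ball y (1 / 2)) := Metric.isOpen_ball
  have hFn : ContDiffOn ℝ n F (Metric.ball y (1 / 2)) := fun z hz =>
    (by simpa [hn] using hF z hz : ContDiffAt ℝ n F z).contDiffWithinAt
  have hs := uniqueDiffOn_Icc hb
  have hst := rk.stage_bound hQ hb hbQ hFn hFQ hAi hbA hα1
    (by linarith : 2 ^ n * n ! * A ≤ α)
  obtain ⟨hmap, hcd, hder⟩ := stage_curve_bound (F := F) (y := y) (c := α ^ S) (J := Finset.univ)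
    (β := rk.b) (B := B) (g := fun j h => rk.stage F h y j) hQ (one_le_pow₀ hα1) hb hbQ hFn hFQ
    le_rfl hbB (fun j _ => (hst j).1) (fun j _ => (hst j).2.1)
    (fun j _ t ht k hk1 hk => ((hst j).2.2 t ht k hk1 hk).trans (by
      gcongr
      exact j.2))
  change Set.MapsTo (fun h => rk.step F h y) _ _ at hmap
  change ContDiffOn ℝ n (fun h => rk.step F h y) _ at hcd
  change ∀ t ∈ Set.Icc 0 b, ∀ i, 1 ≤ i → i ≤ n →
    ‖iteratedDerivWithin i (fun h => rk.step F h y) (Set.Icc 0 b) t‖ ≤ _ at hder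
  have : CompleteSpace W := FiniteDimensional.complete ℝ W
  -- Time 2b rather than b makes the derivatives at 0 and b two-sided, as `HasOrder` and the
  -- conclusion demand.
  obtain ⟨γ, hγ0, hγ⟩ := exists_integralCurve_mem_ball (F := F) (y := y) (r := 1 / 2) (Q := Q)
    (T := 2 * b) (by norm_num) hQ.le (by positivity) (by linarith)
    (fun z hz => (hF z hz).differentiableAt (by simp))
    (fun z hz => by simpa using hFQ z hz 0 (by omega))
    (fun z hz => by
      have := hFQ z hz 1 (by omega)
      rwa [← zero_add 1, ← norm_iteratedFDeriv_fderiv, norm_iteratedFDeriv_zero] at this)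
  have hγd : ∀ t ∈ Set.Ioo (-(2 * b)) (2 * b), HasDerivAt γ (F (γ t)) t := fun t ht =>
    (hγ t (Set.Ioo_subset_Icc_self ht)).2.hasDerivAt (Icc_mem_nhds ht.1 ht.2)
  have hsub : Set.Icc 0 b ⊆ Set.Ioo (-(2 * b)) (2 * b) := fun t ht =>
    ⟨by linarith [ht.1], by linarith [ht.2]⟩
  have hγball : Set.MapsTo γ (Set.Icc 0 b) (Metric.ball y (1 / 2)) := fun t ht =>
    (hγ t (Set.Ioo_subset_Icc_self (hsub ht))).1
  have hγw : ∀ t ∈ Set.Icc 0 b, HasDerivWithinAt γ (F (γ t)) (Set.Icc 0 b) t := fun t ht =>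
    (hγd t (hsub ht)).hasDerivWithinAt
  have hγn : ContDiffOn ℝ n γ (Set.Icc 0 b) :=
    ODE.contDiffOn_enat_Icc_of_hasDerivWithinAt (n := n) (f := fun _ => F)
      (hFn.comp contDiffOn_snd fun z hz => hz.2) hγw hγball
  refine ⟨hmap ⟨hb.le, le_rfl⟩, γ, hγ0, fun t ht => ⟨hγball ht, hγd t (hsub ht)⟩, ?_⟩
  have hO : (fun h : ℝ => rk.step F h y - γ h) =O[𝓝[>] 0] fun h : ℝ => h ^ (s + 1) := by
    have h1 := hrk W F γ (by rw [hγ0]; exact hF y (Metric.mem_ball_self (by norm_num)))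
      (by
        filter_upwards [Ioo_mem_nhds (by linarith : -(2 * b) < 0) (by linarith : 0 < 2 * b)]
          with t ht using hγd t ht)
    rwa [hγ0] at h1
  have hfin := norm_le_of_isBigO_pow (K := C * Q ^ (s + 1)) hb
    (by simpa [hn] using hcd.sub hγn) hO (fun t ht => by
      have e := iteratedDerivWithin_sub (n := n) ht hs (hcd t ht) (hγn t ht)
      change ‖iteratedDerivWithin n ((fun h => rk.step F h y) - γ) (Set.Icc 0 b) t‖ ≤ _
      rw [e]
      refine (norm_sub_le _ _).trans ?_
      have e1 := hder t ht n (by omega) le_rfl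
      have e2 := norm_iteratedDerivWithin_integralCurve_le hU hQ.le hFn hFQ hs hγn hγball hγw
        (k := n) (by omega) le_rfl ht
      rw [mul_pow] at e1 e2
      calc _ ≤ _ := add_le_add e1 e2
        _ = _ := by rw [hCdef]; ring)
  refine hfin.trans (le_of_eq ?_)
  rw [mul_pow]
  ring

/-- A method of positive order is consistent. -/
theorem HasOrder.sum_b_eq_one {S s : ℕ} {rk : RungeKutta S} (hrk : rk.HasOrder s) (hs : 1 ≤ s) :
    ∑ i, rk.b i = 1 := by
  -- For y' = 1 the error is h(∑ b − 1), which is O(h²) only if it vanishes.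
  have h := hrk ℝ (fun _ => 1) id contDiffAt_const
    (Eventually.of_forall fun t => hasDerivAt_id t)
  have h2 : (fun x : ℝ => x ^ (s + 1)) =O[𝓝[>] 0] fun x : ℝ => x ^ 2 := by
    refine IsBigO.of_bound 1 ?_
    filter_upwards [Ioc_mem_nhdsGT (zero_lt_one (α := ℝ))] with x hx
    rw [one_mul, Real.norm_of_nonneg (pow_nonneg hx.1.le _),
      Real.norm_of_nonneg (pow_nonneg hx.1.le _)]
    exact pow_le_pow_of_le_one hx.1.le hx.2 (by omega)
  have h3 := coeff_eq_zero_of_isBigO 2 (fun k => if k = 1 then ∑ i, rk.b i - 1 else 0)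
    ((h.trans h2).congr_left fun x => by
      simp [step, mul_sub]) 1 (by norm_num)
  simpa [sub_eq_zero] using h3

end RungeKutta

/-! ### Calculus of higher derivative bounds. -/

theorem norm_iteratedFDeriv_comp_clm_le {E F G : Type*} [NormedAddCommGroup E] [NormedSpace ℝ E]
    [NormedAddCommGroup F] [NormedSpace ℝ F] [NormedAddCommGroup G] [NormedSpace ℝ G]
    (g : E →L[ℝ] F) {f : F → G} {U : Set F} (hU : IsOpen U) {i : ℕ} (hf : ContDiffOn ℝ i f U)
    {x : E} (hx : g x ∈ U) :
    ‖iteratedFDeriv ℝ i (fun z => f (g z)) x‖ ≤ ‖iteratedFDeriv ℝ i f (g x)‖ * ‖g‖ ^ i := by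
  have hU' : IsOpen (g ⁻¹' U) := hU.preimage g.continuous
  have h := g.iteratedFDerivWithin_comp_right hf hU.uniqueDiffOn hU'.uniqueDiffOn hx le_rfl
  rw [iteratedFDerivWithin_of_isOpen i hU' hx, iteratedFDerivWithin_of_isOpen i hU hx] at h
  change ‖iteratedFDeriv ℝ i (f ∘ g) x‖ ≤ _
  rw [h]
  refine (ContinuousMultilinearMap.norm_compContinuousLinearMap_le _ _).trans (le_of_eq ?_)
  simp

theorem norm_iteratedFDeriv_clm_le {E F : Type*} [NormedAddCommGroup E] [NormedSpace ℝ E]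
    [NormedAddCommGroup F] [NormedSpace ℝ F] (g : E →L[ℝ] F) (i : ℕ) (x : E) :
    ‖iteratedFDeriv ℝ i g x‖ ≤ ‖g x‖ + ‖g‖ := by
  rcases i with _ | i
  · simp
  · rw [← norm_iteratedFDeriv_fderiv]
    have : fderiv ℝ g = fun _ => g := by funext x; exact g.fderiv
    rw [this]
    rcases i with _ | i
    · simp
    · rw [iteratedFDeriv_succ_const]
      simp only [Pi.zero_apply, norm_zero]
      positivity

theorem norm_iteratedFDeriv_smul_le_of_le {E F : Type*} [NormedAddCommGroup E] [NormedSpace ℝ E]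
    [NormedAddCommGroup F] [NormedSpace ℝ F] {a : E → ℝ} {u : E → F} {U : Set E} (hU : IsOpen U)
    {n : ℕ} (ha : ContDiffOn ℝ n a U) (hu : ContDiffOn ℝ n u U) {x : E} (hx : x ∈ U) {α β : ℝ}
    (hα : ∀ i ≤ n, ‖iteratedFDeriv ℝ i a x‖ ≤ α) (hβ : ∀ i ≤ n, ‖iteratedFDeriv ℝ i u x‖ ≤ β)
    {i : ℕ} (hi : i ≤ n) :
    ‖iteratedFDeriv ℝ i (fun z => a z • u z) x‖ ≤ 2 ^ n * (α * β) := by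
  have h := norm_iteratedFDerivWithin_smul_le (𝕜 := ℝ) ha hu hU.uniqueDiffOn hx (n := i)
    (by exact_mod_cast hi)
  simp only [iteratedFDerivWithin_of_isOpen _ hU hx] at h
  have hα0 : 0 ≤ α := (norm_nonneg _).trans (hα 0 (by omega))
  have hβ0 : 0 ≤ β := (norm_nonneg _).trans (hβ 0 (by omega))
  calc _ ≤ _ := h
    _ ≤ ∑ k ∈ Finset.range (i + 1), (i.choose k : ℝ) * (α * β) := by
        refine Finset.sum_le_sum fun k hk => ?_
        have hk : k ≤ i := by simpa [Nat.lt_succ_iff] using hk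
        rw [mul_assoc]
        gcongr
        · exact hα k (by omega)
        · exact hβ (i - k) (by omega)
    _ = 2 ^ i * (α * β) := by
        rw [← Finset.sum_mul]
        congr 1
        exact_mod_cast Nat.sum_range_choose i
    _ ≤ _ := by
        gcongr
        norm_num

section Gradient

variable {E : Type*} [NormedAddCommGroup E] [InnerProductSpace ℝ E] [CompleteSpace E]

/-- The Riesz isomorphism as a real linear isometry. -/
noncomputable def rieszIsometry (E : Type*) [NormedAddCommGroup E] [InnerProductSpace ℝ E]
    [CompleteSpace E] : StrongDual ℝ E ≃ₗᵢ[ℝ] E :=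
  (InnerProductSpace.toDual ℝ E).symm

theorem gradient_eq_rieszIsometry_comp (f : E → ℝ) : gradient f = rieszIsometry E ∘ fderiv ℝ f :=
  rfl

theorem norm_iteratedFDeriv_gradient (f : E → ℝ) (i : ℕ) (x : E) :
    ‖iteratedFDeriv ℝ i (gradient f) x‖ = ‖iteratedFDeriv ℝ (i + 1) f x‖ := by
  rw [gradient_eq_rieszIsometry_comp, LinearIsometryEquiv.norm_iteratedFDeriv_comp_left,
    norm_iteratedFDeriv_fderiv]

theorem ContDiff.gradient {f : E → ℝ} {n : ℕ} (hf : ContDiff ℝ (n + 1) f) :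
    ContDiff ℝ n (gradient f) := by
  rw [gradient_eq_rieszIsometry_comp]
  exact (rieszIsometry E).contDiff.comp (hf.fderiv_right le_rfl)

end Gradient

open scoped Nat in
theorem abs_iteratedDeriv_inv_le {t : ℝ} (ht : 1 / 2 ≤ t) {n i : ℕ} (hi : i ≤ n) :
    ‖iteratedDeriv i (fun x : ℝ => x⁻¹) t‖ ≤ n ! * 2 ^ (n + 1) := by
  have ht0 : 0 < t := by linarith
  rw [iteratedDeriv_eq_iterate]
  change ‖deriv^[i] Inv.inv t‖ ≤ _
  rw [iter_deriv_inv, norm_mul, norm_mul, norm_pow, norm_neg, norm_one, one_pow, one_mul]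
  have h1 : t ^ (-1 - (i : ℤ)) = (t⁻¹) ^ (i + 1) := by
    rw [inv_pow, ← zpow_natCast, ← zpow_neg]
    congr 1
    push_cast
    ring
  have h2 : t⁻¹ ≤ 2 := by
    rw [inv_le_comm₀ ht0 (by norm_num)]
    linarith
  rw [h1, Real.norm_of_nonneg (by positivity : (0 : ℝ) ≤ (i ! : ℝ)),
    Real.norm_of_nonneg (by positivity)]
  have h3 : (i ! : ℝ) ≤ n ! := by exact_mod_cast Nat.factorial_le hi
  have h4 : (t⁻¹) ^ (i + 1) ≤ 2 ^ (n + 1) := by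
    calc (t⁻¹) ^ (i + 1) ≤ 2 ^ (i + 1) := by gcongr
      _ ≤ 2 ^ (n + 1) := pow_le_pow_right₀ (by norm_num) (by omega)
  gcongr

theorem abs_iteratedDeriv_pow_le {t τ : ℝ} (ht : 0 ≤ t) (hτ : 1 ≤ τ) (htτ : t ≤ 2 * τ) (m : ℕ)
    {n i : ℕ} (hi : i ≤ n) :
    ‖iteratedDeriv i (fun x : ℝ => x ^ m) t‖ ≤ ((m : ℝ) + 1) ^ n * 2 ^ m * τ ^ m := by
  rw [iteratedDeriv_pow, norm_mul, Real.norm_of_nonneg (Nat.cast_nonneg _),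
    Real.norm_of_nonneg (pow_nonneg ht _), mul_assoc, ← mul_pow]
  have h1 : ((m.descFactorial i : ℕ) : ℝ) ≤ ((m : ℝ) + 1) ^ n := by
    calc ((m.descFactorial i : ℕ) : ℝ) ≤ (m : ℝ) ^ i := by
          exact_mod_cast Nat.descFactorial_le_pow _ _
      _ ≤ ((m : ℝ) + 1) ^ i := by
          gcongr
          linarith
      _ ≤ ((m : ℝ) + 1) ^ n := pow_le_pow_right₀ (by linarith [Nat.cast_nonneg (α := ℝ) m]) hi
  have h2 : t ^ (m - i) ≤ (2 * τ) ^ m := by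
    calc t ^ (m - i) ≤ (2 * τ) ^ (m - i) := by gcongr
      _ ≤ (2 * τ) ^ m := pow_le_pow_right₀ (by linarith) (by omega)
  gcongr

/-! ### The rescaled vector field. -/

/-- The vector field `dynamics f p` in the coordinates `w = τ v`, `ξ = τ A x`, `t`. -/
noncomputable def scaledDynamics {d : ℕ} (f : EuclideanSpace ℝ (Fin d) → ℝ) (p : ℕ) (τ A : ℝ)
    (z : PhaseState d) : PhaseState d :=
  (-((2 * (p : ℝ) + 1) * z.2.2⁻¹) • z.1
      - ((p : ℝ) ^ 2 * τ * z.2.2 ^ (p - 2)) • gradient f ((τ * A)⁻¹ • z.2.1),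
    A • z.1, 1)

/-- The change of coordinates from `(w, ξ, t)` to `(v, x, t)`. -/
noncomputable def unscale {d : ℕ} (τ A : ℝ) : PhaseState d →ₗ[ℝ] PhaseState d where
  toFun z := (τ⁻¹ • z.1, (τ * A)⁻¹ • z.2.1, z.2.2)
  map_add' y z := by simp
  map_smul' c z := by simp [smul_comm c]

/-- The conjugacy that lets a step be estimated in scaled coordinates, where τv has the size
controlled by the energy and a unit of ξ is the length 1/(τA) on which `f` varies moderately. -/
theorem dynamics_unscale {d : ℕ} (f : EuclideanSpace ℝ (Fin d) → ℝ) (p : ℕ) {τ A : ℝ}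
    (hτ : τ ≠ 0) (hA : A ≠ 0) (z : PhaseState d) :
    dynamics f p (unscale τ A z) = unscale τ A (scaledDynamics f p τ A z) := by
  simp only [dynamics, unscale, scaledDynamics, LinearMap.coe_mk, AddHom.coe_mk, Prod.mk.injEq,
    smul_sub, smul_smul, and_true]
  constructor
  · congr 2
    · field_simp
    · field_simp
  · congr 1
    field_simp

theorem RungeKutta.stage_map {S : ℕ} (rk : RungeKutta S) {V V' : Type*} [AddCommGroup V]
    [Module ℝ V] [AddCommGroup V'] [Module ℝ V'] (T : V →ₗ[ℝ] V') {F : V → V} {F' : V' → V'}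
    (hT : ∀ z, F' (T z) = T (F z)) (h : ℝ) (y : V) (i : Fin S) :
    rk.stage F' h (T y) i = T (rk.stage F h y i) := by
  induction i using WellFoundedLT.induction with
  | ind i ih =>
    rw [stage_eq, stage_eq, map_add, map_smul, map_sum]
    congr 2
    refine Finset.sum_congr rfl fun j hj => ?_
    rw [ih j (Finset.mem_Iio.1 hj), hT, map_smul]

/-- Runge-Kutta methods commute with linear changes of coordinates. -/
theorem RungeKutta.step_map {S : ℕ} (rk : RungeKutta S) {V V' : Type*} [AddCommGroup V]
    [Module ℝ V] [AddCommGroup V'] [Module ℝ V'] (T : V →ₗ[ℝ] V') {F : V → V} {F' : V' → V'}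
    (hT : ∀ z, F' (T z) = T (F z)) (h : ℝ) (y : V) :
    rk.step F' h (T y) = T (rk.step F h y) := by
  simp only [step, rk.stage_map T hT, hT, map_add, map_smul, map_sum]

theorem contDiffOn_scaledDynamics {d : ℕ} {f : EuclideanSpace ℝ (Fin d) → ℝ} {p n : ℕ} {τ A : ℝ}
    (hf : ContDiff ℝ (n + 1) f) :
    ContDiffOn ℝ n (scaledDynamics f p τ A) {z | 0 < z.2.2} := by
  have hg := hf.gradient
  have hinv : ContDiffOn ℝ n (fun z : PhaseState d => z.2.2⁻¹) {z | 0 < z.2.2} :=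
    (by fun_prop : ContDiff ℝ n fun z : PhaseState d => z.2.2).contDiffOn.inv
      fun z hz => (ne_of_gt hz)
  have hgc : ContDiff ℝ n (fun z : PhaseState d => gradient f ((τ * A)⁻¹ • z.2.1)) :=
    hg.comp (by fun_prop)
  refine ContDiffOn.prodMk (((contDiffOn_const.mul hinv).neg.smul contDiffOn_fst).sub
    (ContDiff.contDiffOn (ContDiff.smul (f := fun z : PhaseState d => (p : ℝ) ^ 2 * τ * z.2.2 ^ (p - 2))
      (by fun_prop) hgc))) (ContDiff.contDiffOn (by fun_prop))

open scoped Nat in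
/-- The derivatives of the scaled vector field are bounded by a multiple of `A * B` whenever the
derivatives of `f` have the size dictated by the scaling. -/
theorem exists_scaledDynamics_bound (p n : ℕ) (hp : 2 ≤ p) : ∃ K : ℝ, 0 < K ∧
    ∀ (d : ℕ) (f : EuclideanSpace ℝ (Fin d) → ℝ) (τ A B : ℝ) (z : PhaseState d),
      ContDiff ℝ (n + 1) f → 1 ≤ τ → 1 ≤ A → 1 ≤ B → 1 / 2 ≤ z.2.2 → z.2.2 ≤ 2 * τ →
      ‖z.1‖ ≤ 3 * p * B →
      (∀ i, 1 ≤ i → i ≤ n + 1 →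
        τ ^ p * ‖iteratedFDeriv ℝ i f ((τ * A)⁻¹ • z.2.1)‖ ≤ τ ^ i * (A * (3 * B))) →
      ∀ i ≤ n, ‖iteratedFDeriv ℝ i (scaledDynamics f p τ A) z‖ ≤ K * (A * B) := by
  -- `K1` bounds the damping term and `K2` the gradient term, each with the Leibniz factor 2^n; the
  -- summand 4p below serves the components A·w and 1.
  set K1 : ℝ := 2 ^ n * (((2 * p + 1) * (n ! * 2 ^ (n + 1))) * (4 * p)) with hK1
  set K2 : ℝ := 2 ^ n * (p ^ 2 * (((p - 2 : ℕ) + 1 : ℝ) ^ n * 2 ^ (p - 2)) * 3) with hK2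
  have hp' : (2 : ℝ) ≤ p := by exact_mod_cast hp
  refine ⟨K1 + K2 + 4 * p, by positivity, ?_⟩
  intro d f τ A B z hf hτ hA hB ht htτ hw hfb i hi
  have hτ0 : 0 < τ := by linarith
  have hA0 : 0 < A := by linarith
  have ht0 : 0 < z.2.2 := by linarith
  have hAB : 1 ≤ A * B := one_le_mul_of_one_le_of_one_le hA hB
  have hBAB : B ≤ A * B := le_mul_of_one_le_left (by linarith) hA
  set U : Set (PhaseState d) := {z | 0 < z.2.2}
  have hU : IsOpen U := isOpen_lt continuous_const (by fun_prop)
  have hzU : z ∈ U := ht0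
  let T : PhaseState d →L[ℝ] ℝ :=
    (ContinuousLinearMap.snd ℝ _ _).comp (ContinuousLinearMap.snd ℝ _ _)
  let X : PhaseState d →L[ℝ] EuclideanSpace ℝ (Fin d) :=
    (τ * A)⁻¹ • (ContinuousLinearMap.fst ℝ _ _).comp (ContinuousLinearMap.snd ℝ _ _)
  let P : PhaseState d →L[ℝ] EuclideanSpace ℝ (Fin d) := ContinuousLinearMap.fst ℝ _ _
  have hP : ‖P‖ ≤ 1 := ContinuousLinearMap.norm_fst_le _ _ _
  have hT : ‖T‖ ≤ 1 := by
    refine T.opNorm_le_bound zero_le_one fun z => ?_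
    rw [one_mul]
    exact (norm_snd_le z.2).trans (norm_snd_le z)
  have hX : ‖X‖ ≤ (τ * A)⁻¹ := by
    refine X.opNorm_le_bound (by positivity) fun z => ?_
    change ‖(τ * A)⁻¹ • z.2.1‖ ≤ _
    rw [norm_smul, Real.norm_of_nonneg (by positivity)]
    gcongr
    exact (norm_fst_le z.2).trans (norm_snd_le z)
  have hw1 : ∀ j ≤ n, ‖iteratedFDeriv ℝ j (fun z : PhaseState d => z.1) z‖ ≤ 4 * p * B := by
    intro j _
    refine (norm_iteratedFDeriv_clm_le P j z).trans ?_
    change ‖z.1‖ + _ ≤ _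
    have : 1 ≤ p * B := one_le_mul_of_one_le_of_one_le (by linarith) hB
    linarith
  have hpi : ∀ j, ‖T‖ ^ j ≤ 1 := fun j => pow_le_one₀ (norm_nonneg _) hT
  have hinvd : ∀ j ≤ n, ‖iteratedFDeriv ℝ j
      (fun z : PhaseState d => -((2 * (p : ℝ) + 1) * z.2.2⁻¹)) z‖ ≤
      (2 * p + 1) * (n ! * 2 ^ (n + 1)) := by
    intro j hj
    have hcd : ContDiffOn ℝ j (fun x : ℝ => -((2 * (p : ℝ) + 1) * x⁻¹)) (Set.Ioi 0) :=
      (contDiffOn_const.mul (contDiffOn_id.inv fun x hx => ne_of_gt hx)).neg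
    refine (norm_iteratedFDeriv_comp_clm_le T isOpen_Ioi hcd (x := z) ht0).trans ?_
    refine (mul_le_of_le_one_right (norm_nonneg _) (hpi j)).trans ?_
    rw [norm_iteratedFDeriv_eq_norm_iteratedDeriv, iteratedDeriv_fun_neg,
      iteratedDeriv_const_mul_field, norm_neg, norm_mul, Real.norm_of_nonneg (by positivity)]
    gcongr
    exact abs_iteratedDeriv_inv_le ht hj
  have hpowd : ∀ j ≤ n, ‖iteratedFDeriv ℝ j
      (fun z : PhaseState d => (p : ℝ) ^ 2 * τ * z.2.2 ^ (p - 2)) z‖ ≤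
      p ^ 2 * τ * (((p - 2 : ℕ) + 1 : ℝ) ^ n * 2 ^ (p - 2) * τ ^ (p - 2)) := by
    intro j hj
    have hcd : ContDiffOn ℝ j (fun x : ℝ => (p : ℝ) ^ 2 * τ * x ^ (p - 2)) Set.univ :=
      ContDiff.contDiffOn (by fun_prop)
    refine (norm_iteratedFDeriv_comp_clm_le T isOpen_univ hcd (x := z) trivial).trans ?_
    refine (mul_le_of_le_one_right (norm_nonneg _) (hpi j)).trans ?_
    rw [norm_iteratedFDeriv_eq_norm_iteratedDeriv,
      iteratedDeriv_const_mul_field, norm_mul, Real.norm_of_nonneg (by positivity)]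
    gcongr
    exact abs_iteratedDeriv_pow_le ht0.le hτ htτ _ hj
  have hgd : ∀ j ≤ n, ‖iteratedFDeriv ℝ j
      (fun z : PhaseState d => gradient f ((τ * A)⁻¹ • z.2.1)) z‖ ≤
      τ / τ ^ p * (A * (3 * B)) := by
    intro j hj
    have hcd : ContDiffOn ℝ j (gradient f) Set.univ :=
      (hf.gradient.of_le (by exact_mod_cast hj)).contDiffOn
    refine (norm_iteratedFDeriv_comp_clm_le X isOpen_univ hcd (x := z) trivial).trans ?_
    rw [norm_iteratedFDeriv_gradient]
    change ‖iteratedFDeriv ℝ (j + 1) f ((τ * A)⁻¹ • z.2.1)‖ * ‖X‖ ^ j ≤ _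
    have h1 := hfb (j + 1) (by omega) (by omega)
    -- The j chain-rule factors cancel all but one τ of the τ^(j+1) allowed for the derivative of
    -- order j+1 of `f`.
    have h2 : ‖X‖ ^ j ≤ (τ ^ j)⁻¹ := by
      calc ‖X‖ ^ j ≤ ((τ * A)⁻¹) ^ j := by gcongr
        _ ≤ (τ⁻¹) ^ j := by
          gcongr
          exact le_mul_of_one_le_right hτ0.le hA
        _ = _ := inv_pow _ _
    calc _ ≤ (τ ^ (j + 1) * (A * (3 * B)) / τ ^ p) * (τ ^ j)⁻¹ := by
          gcongr
          rw [le_div_iff₀ (by positivity)]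
          linarith
      _ = _ := by
          field_simp
          ring
  have hinvc : ContDiffOn ℝ n (fun z : PhaseState d => -((2 * (p : ℝ) + 1) * z.2.2⁻¹)) U :=
    (contDiffOn_const.mul
      ((by fun_prop : ContDiff ℝ n fun z : PhaseState d => z.2.2).contDiffOn.inv
        fun z hz => (ne_of_gt hz))).neg
  have hpowc : ContDiffOn ℝ n (fun z : PhaseState d => (p : ℝ) ^ 2 * τ * z.2.2 ^ (p - 2)) U :=
    ContDiff.contDiffOn (by fun_prop)
  have hgc : ContDiffOn ℝ n (fun z : PhaseState d => gradient f ((τ * A)⁻¹ • z.2.1)) U :=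
    (hf.gradient.comp (by fun_prop)).contDiffOn
  have hfc : ContDiffOn ℝ n (fun z : PhaseState d => z.1) U := contDiffOn_fst
  have b1 := norm_iteratedFDeriv_smul_le_of_le hU hinvc hfc hzU hinvd hw1 hi
  have b2 := norm_iteratedFDeriv_smul_le_of_le hU hpowc hgc hzU hpowd hgd hi
  have hle : (i : WithTop ℕ∞) ≤ n := by exact_mod_cast hi
  have hUz : U ∈ 𝓝 z := hU.mem_nhds hzU
  have c1 : ContDiffAt ℝ n (fun z : PhaseState d => -((2 * (p : ℝ) + 1) * z.2.2⁻¹) • z.1) z :=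
    (hinvc.smul hfc).contDiffAt hUz
  have c2 : ContDiffAt ℝ n (fun z : PhaseState d => ((p : ℝ) ^ 2 * τ * z.2.2 ^ (p - 2)) •
      gradient f ((τ * A)⁻¹ • z.2.1)) z := (hpowc.smul hgc).contDiffAt hUz
  have c3 : ContDiffAt ℝ n (fun z : PhaseState d => A • z.1) z := by fun_prop
  have c4 : ContDiffAt ℝ n (fun _ : PhaseState d => (1 : ℝ)) z := contDiffAt_const
  have b3 : ‖iteratedFDeriv ℝ i (fun z : PhaseState d => A • z.1) z‖ ≤ A * (4 * p * B) := by
    change ‖iteratedFDeriv ℝ i (A • fun z : PhaseState d => z.1) z‖ ≤ _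
    rw [iteratedFDeriv_const_smul_apply contDiffAt_fst, norm_smul,
      Real.norm_of_nonneg hA0.le]
    gcongr
    exact hw1 i hi
  have b4 : ‖iteratedFDeriv ℝ i (fun _ : PhaseState d => (1 : ℝ)) z‖ ≤ 1 := by
    rcases i with _ | i
    · simp
    · rw [iteratedFDeriv_succ_const]; simp
  have hK1p : 0 ≤ K1 := by positivity
  have hK2p : 0 ≤ K2 := by positivity
  have hABK : 1 ≤ 4 * (p : ℝ) * (A * B) :=
    one_le_mul_of_one_le_of_one_le (by linarith) hAB
  have hKAB1 : 0 ≤ K1 * (A * B) := by positivity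
  have hKAB2 : 0 ≤ K2 * (A * B) := by positivity
  have hsum : (K1 + K2 + 4 * p) * (A * B) = K1 * (A * B) + K2 * (A * B) + 4 * p * (A * B) := by
    ring
  rw [hsum]
  have e : iteratedFDeriv ℝ i (scaledDynamics f p τ A) z = _ :=
    iteratedFDeriv_prodMk (c1.sub c2) (c3.prodMk c4) hle
  rw [e, ContinuousMultilinearMap.opNorm_prod, iteratedFDeriv_prodMk c3 c4 hle,
    ContinuousMultilinearMap.opNorm_prod]
  refine max_le ?_ (max_le ?_ ?_)
  · have e2 := iteratedFDeriv_sub_apply (c1.of_le hle) (c2.of_le hle)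
    change ‖iteratedFDeriv ℝ i ((fun z : PhaseState d => -((2 * (p : ℝ) + 1) * z.2.2⁻¹) • z.1) -
      fun z : PhaseState d => ((p : ℝ) ^ 2 * τ * z.2.2 ^ (p - 2)) •
        gradient f ((τ * A)⁻¹ • z.2.1)) z‖ ≤ _
    rw [e2]
    refine (norm_sub_le _ _).trans ((add_le_add b1 b2).trans ?_)
    have r1 : (2 : ℝ) ^ n * ((2 * p + 1) * (n ! * 2 ^ (n + 1)) * (4 * p * B)) = K1 * B := by
      rw [hK1]; ring
    -- The powers τ, τ^(p-2) and τ^(1-p) multiply to 1, so the bound does not deteriorate with time.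
    have r2 : (2 : ℝ) ^ n * (p ^ 2 * τ * (((p - 2 : ℕ) + 1 : ℝ) ^ n * 2 ^ (p - 2) * τ ^ (p - 2)) *
        (τ / τ ^ p * (A * (3 * B)))) = K2 * (A * B) := by
      have : τ ^ p = τ * τ * τ ^ (p - 2) := by
        rw [mul_assoc, ← pow_succ', ← pow_succ']
        congr 1
        omega
      rw [hK2, this]
      field_simp
    rw [r1, r2]
    have : K1 * B ≤ K1 * (A * B) := by gcongr
    linarith
  · have : A * (4 * p * B) = 4 * p * (A * B) := by ring
    linarith
  · linarith

/-! ### Consequences of the growth condition and of convexity. -/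

/-- The derivatives of `f` at a point where the growth condition and the derivative bounds hold. -/
theorem pow_mul_norm_iteratedFDeriv_le {E : Type*} [NormedAddCommGroup E] [NormedSpace ℝ E]
    {f : E → ℝ} {x : E} {p m i : ℕ} {L M g τ : ℝ} (hL : 0 < L) (hM : 0 ≤ M) (hg : 0 ≤ g)
    (hτ : 1 ≤ τ)
    (hgrow : ∀ i : ℕ, 1 ≤ i → i < p →
      (1 / L) * ‖iteratedFDeriv ℝ i f x‖ ^ ((p : ℝ) / ((p : ℝ) - (i : ℝ))) ≤ g)
    (hbd : ∀ i : ℕ, p ≤ i → i ≤ m → ‖iteratedFDeriv ℝ i f x‖ ≤ M) (hi1 : 1 ≤ i) (hi : i ≤ m) :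
    τ ^ p * ‖iteratedFDeriv ℝ i f x‖ ≤ τ ^ i * ((L + M + 1) * (τ ^ p * g + 1)) := by
  have hτ0 : 0 < τ := by linarith
  have hG : 1 ≤ τ ^ p * g + 1 := by
    have : 0 ≤ τ ^ p * g := by positivity
    linarith
  have hZ : 1 ≤ (L + M + 1) * (τ ^ p * g + 1) := one_le_mul_of_one_le_of_one_le (by linarith) hG
  rcases lt_or_ge i p with hip | hip
  · set D := ‖iteratedFDeriv ℝ i f x‖ with hD
    have hD0 : 0 ≤ D := norm_nonneg _
    have hpi : (0 : ℝ) < (p : ℝ) - i := by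
      have : (i : ℝ) < p := by exact_mod_cast hip
      linarith
    set q : ℝ := (p : ℝ) / ((p : ℝ) - i) with hq
    have hq1 : 1 ≤ q := by
      rw [hq, one_le_div hpi]
      linarith [Nat.cast_nonneg (α := ℝ) i]
    have h1 : D ^ q ≤ L * g := by
      have := hgrow i hi1 hip
      rw [one_div, inv_mul_le_iff₀ hL] at this
      exact this
    -- The exponent q = p/(p−i) turns τ^(p−i) into exactly τ^p.
    have h2 : (τ ^ (p - i) * D) ^ q ≤ (L + M + 1) * (τ ^ p * g + 1) := by
      rw [Real.mul_rpow (by positivity) hD0]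
      have e : (τ ^ (p - i)) ^ q = τ ^ p := by
        rw [← Real.rpow_natCast τ (p - i), ← Real.rpow_mul hτ0.le, Nat.cast_sub hip.le, hq,
          mul_div_cancel₀ _ hpi.ne', Real.rpow_natCast]
      rw [e]
      calc τ ^ p * D ^ q ≤ τ ^ p * (L * g) := by gcongr
        _ = L * (τ ^ p * g) := by ring
        _ ≤ (L + M + 1) * (τ ^ p * g + 1) := by
          have : 0 ≤ τ ^ p * g := by positivity
          gcongr <;> linarith
    -- Since q ≥ 1, the q-th power can be dropped above 1; below 1 the bound is trivial by `hZ`.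
    have h3 : τ ^ (p - i) * D ≤ (L + M + 1) * (τ ^ p * g + 1) := by
      rcases le_total 1 (τ ^ (p - i) * D) with h | h
      · exact (Real.self_le_rpow_of_one_le h hq1).trans h2
      · exact h.trans hZ
    calc τ ^ p * D = τ ^ i * (τ ^ (p - i) * D) := by
          rw [← mul_assoc, ← pow_add, Nat.add_sub_cancel' hip.le]
      _ ≤ _ := by gcongr
  · have h1 : τ ^ p ≤ τ ^ i := pow_le_pow_right₀ hτ hip
    have h2 : ‖iteratedFDeriv ℝ i f x‖ ≤ (L + M + 1) * (τ ^ p * g + 1) := by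
      calc _ ≤ M := hbd i hip hi
        _ ≤ L + M + 1 := by linarith
        _ ≤ _ := le_mul_of_one_le_right (by linarith) hG
    gcongr

/-- If the logarithmic derivative of `τ ^ p * (f - m) + 1` is bounded by `ρ` in a unit ball, then
this function varies at most by a factor `e` over a distance `1 / ρ`. -/
theorem growth_le_exp_mul {E : Type*} [NormedAddCommGroup E] [NormedSpace ℝ E]
    {f : E → ℝ} {m c ρ : ℝ} (hc : 0 ≤ c) (hm : ∀ x, m ≤ f x) (hf : Differentiable ℝ f) {x y : E}
    (hd : ∀ z ∈ Metric.closedBall x 1, c * ‖fderiv ℝ f z‖ ≤ ρ * (c * (f z - m) + 1))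
    (hy : y ∈ Metric.closedBall x 1) (hxy : ρ * ‖y - x‖ ≤ 1) :
    c * (f y - m) + 1 ≤ Real.exp 1 * (c * (f x - m) + 1) := by
  set G : E → ℝ := fun z => c * (f z - m) + 1 with hG
  have hpos : ∀ z, 0 < G z := fun z => by
    have : 0 ≤ c * (f z - m) := mul_nonneg hc (by linarith [hm z])
    change 0 < c * (f z - m) + 1
    linarith
  have hder : ∀ z, HasFDerivAt (fun z => Real.log (G z)) ((G z)⁻¹ • (c • fderiv ℝ f z)) z := by
    intro z
    exact ((((hf z).hasFDerivAt.sub_const m).const_mul c).add_const 1).log (hpos z).ne'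
  have h := (convex_closedBall x 1).norm_image_sub_le_of_norm_hasFDerivWithin_le
    (f := fun z => Real.log (G z)) (C := ρ) (fun z _ => (hder z).hasFDerivWithinAt)
    (fun z hz => by
      rw [norm_smul, norm_smul, Real.norm_of_nonneg hc,
        Real.norm_of_nonneg (inv_nonneg.2 (hpos z).le), inv_mul_le_iff₀ (hpos z), mul_comm _ ρ]
      exact hd z hz)
    (Metric.mem_closedBall_self zero_le_one) hy
  have h1 : Real.log (G y) ≤ 1 + Real.log (G x) := by
    have := (le_abs_self _).trans (h.trans hxy)
    linarith
  calc G y = Real.exp (Real.log (G y)) := (Real.exp_log (hpos y)).symm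
    _ ≤ Real.exp (1 + Real.log (G x)) := Real.exp_le_exp.2 h1
    _ = Real.exp 1 * G x := by rw [Real.exp_add, Real.exp_log (hpos x)]

/-- The first order characterization of convexity. -/
theorem ConvexOn.add_inner_gradient_le {E : Type*} [NormedAddCommGroup E]
    [InnerProductSpace ℝ E] [CompleteSpace E] {f : E → ℝ} (hf : ConvexOn ℝ Set.univ f)
    (hd : Differentiable ℝ f) (x y : E) :
    f x + inner ℝ (gradient f x) (y - x) ≤ f y := by
  have hline : ConvexOn ℝ Set.univ (fun s : ℝ => f (AffineMap.lineMap x y s)) :=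
    hf.comp_affineMap (AffineMap.lineMap x y : ℝ →ᵃ[ℝ] E)
  have hder : HasDerivAt (fun s : ℝ => f (AffineMap.lineMap x y s))
      (inner ℝ (gradient f x) (y - x)) 0 := by
    have h1 : HasDerivAt (fun s : ℝ => (AffineMap.lineMap x y s : E)) (y - x) 0 :=
      AffineMap.hasDerivAt_lineMap
    have h2 : HasFDerivAt f (fderiv ℝ f x) (AffineMap.lineMap x y (0 : ℝ)) := by
      rw [AffineMap.lineMap_apply_zero]
      exact (hd x).hasFDerivAt
    have h3 := h2.comp_hasDerivAt (0 : ℝ) h1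
    rw [← InnerProductSpace.toDual_apply_apply, toDual_gradient]
    exact h3
  have := hline.le_slope_of_hasDerivAt (Set.mem_univ 0) (Set.mem_univ 1) zero_lt_one hder
  rw [slope_def_field] at this
  simp only [AffineMap.lineMap_apply_zero, AffineMap.lineMap_apply_one, sub_zero, div_one] at this
  linarith

/-! ### Decay of the energy along the flow. -/

section Energy

variable {d : ℕ}

theorem lyapunov_nonneg {f : EuclideanSpace ℝ (Fin d) → ℝ} {xstar : EuclideanSpace ℝ (Fin d)}
    {p : ℕ} {y : PhaseState d} (hmin : ∀ x, f xstar ≤ f x) (ht : 0 ≤ y.2.2) :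
    0 ≤ lyapunov f xstar p y := by
  have : 0 ≤ f y.2.1 - f xstar := sub_nonneg.2 (hmin _)
  unfold lyapunov
  positivity

/-- The Lyapunov function is nonincreasing along integral curves of the dynamics. -/
theorem lyapunov_le_of_integralCurve {f : EuclideanSpace ℝ (Fin d) → ℝ}
    {xstar : EuclideanSpace ℝ (Fin d)} {p : ℕ} (hp : 2 ≤ p) (hf : ConvexOn ℝ Set.univ f)
    (hd : Differentiable ℝ f) {γ : ℝ → PhaseState d} {h : ℝ} (hh : 0 ≤ h)
    (hγ : ∀ t ∈ Set.Icc 0 h, HasDerivAt γ (dynamics f p (γ t)) t)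
    (hpos : ∀ t ∈ Set.Icc 0 h, 0 < (γ t).2.2) :
    lyapunov f xstar p (γ h) ≤ lyapunov f xstar p (γ 0) := by
  have key : ∀ t ∈ Set.Icc 0 h, ∃ D ≤ 0,
      HasDerivAt (fun r => lyapunov f xstar p (γ r)) D t := by
    intro t ht
    have hp0 : (p : ℝ) ≠ 0 := by
      have : p ≠ 0 := by omega
      exact_mod_cast this
    have hτ := hpos t ht
    have h0 := hγ t ht
    have hv : HasDerivAt (fun r => (γ r).1) (dynamics f p (γ t)).1 t := h0.fst
    have hx : HasDerivAt (fun r => (γ r).2.1) (dynamics f p (γ t)).2.1 t := h0.snd.fst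
    have hτd : HasDerivAt (fun r => (γ r).2.2) (dynamics f p (γ t)).2.2 t := h0.snd.snd
    have hfx : HasDerivAt (fun r => f (γ r).2.1) (inner ℝ (gradient f (γ t).2.1) (γ t).1) t := by
      rw [← InnerProductSpace.toDual_apply_apply, toDual_gradient]
      exact (hd _).hasFDerivAt.comp_hasDerivAt t hx
    have hconv := hf.add_inner_gradient_le hd (γ t).2.1 xstar
    -- The damping coefficient 2p+1 makes the v-terms cancel: 1 + 1/(2p) − (2p+1)/(2p) = 0, leaving
    -- a multiple of the gradient.
    have hw : HasDerivAt (fun r => (γ r).2.1 + ((γ r).2.2 / (2 * (p : ℝ))) • (γ r).1 - xstar)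
        (-((p : ℝ) / 2 * (γ t).2.2 ^ (p - 1)) • gradient f (γ t).2.1) t := by
      refine ((hx.add ((hτd.div_const (2 * (p : ℝ))).smul hv)).sub_const xstar).congr_deriv ?_
      have e : (γ t).2.2 ^ (p - 1) = (γ t).2.2 * (γ t).2.2 ^ (p - 2) := by
        rw [← pow_succ']
        congr 1
        omega
      simp only [dynamics, smul_sub, smul_smul, e]
      have e1 : (γ t).2.2 / (2 * (p : ℝ)) * -((2 * (p : ℝ) + 1) / (γ t).2.2) =
          -1 - 1 / (2 * p) := by
        field_simp
        ring
      have e2 : (γ t).2.2 / (2 * (p : ℝ)) * ((p : ℝ) ^ 2 * (γ t).2.2 ^ (p - 2)) =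
          (p : ℝ) / 2 * ((γ t).2.2 * (γ t).2.2 ^ (p - 2)) := by
        field_simp
      rw [e1, e2]
      module
    have hE := (((hτd.pow 2).div_const (4 * (p : ℝ) ^ 2)).mul hv.norm_sq).add hw.norm_sq |>.add
      ((hτd.pow p).mul (hfx.sub_const (f xstar)))
    refine ⟨_, ?_, hE⟩
    simp only [dynamics, Pi.pow_apply]
    set v := (γ t).1
    set x := (γ t).2.1
    set τ := (γ t).2.2
    set g := gradient f x
    have e0 : τ ^ p = τ * τ * τ ^ (p - 2) := by
      rw [mul_assoc, ← pow_succ', ← pow_succ']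
      congr 1
      omega
    have e1 : τ ^ (p - 1) = τ * τ ^ (p - 2) := by
      rw [← pow_succ']
      congr 1
      omega
    have hin : inner ℝ g (xstar - x) = - inner ℝ (x - xstar) g := by
      rw [← neg_sub, inner_neg_right, real_inner_comm]
    rw [hin] at hconv
    simp only [inner_sub_right, inner_smul_right, inner_add_left, inner_sub_left, inner_smul_left,
      real_inner_self_eq_norm_sq, e0, e1, Real.ringHom_apply, real_inner_comm v g] at hconv ⊢
    -- The ⟨v, ∇f⟩ terms have coefficients −1/2, −1/2 and 1 times τ^p and cancel; what is left is a
    -- negative square and the convexity defect at x*.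
    have hid : ((2 : ℕ) : ℝ) * τ ^ (2 - 1) * 1 / (4 * p ^ 2) * ‖v‖ ^ 2 +
          τ ^ 2 / (4 * p ^ 2) *
            (2 * (-((2 * p + 1) / τ) * ‖v‖ ^ 2 - p ^ 2 * τ ^ (p - 2) * inner ℝ v g)) +
        2 * (-(p / 2 * (τ * τ ^ (p - 2))) *
          (inner ℝ x g + τ / (2 * p) * inner ℝ v g - inner ℝ xstar g)) +
      (p * (τ * τ ^ (p - 2)) * 1 * (f x - f xstar) + τ * τ * τ ^ (p - 2) * inner ℝ v g) =
      -(τ / p * ‖v‖ ^ 2) + p * (τ * τ ^ (p - 2)) *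
        (f x + -(inner ℝ x g - inner ℝ xstar g) - f xstar) := by
      push_cast
      field_simp
      ring
    rw [hid]
    have h1 : 0 ≤ τ / p * ‖v‖ ^ 2 := by positivity
    have h2 : (p : ℝ) * (τ * τ ^ (p - 2)) *
        (f x + -(inner ℝ x g - inner ℝ xstar g) - f xstar) ≤ 0 :=
      mul_nonpos_of_nonneg_of_nonpos (by positivity) (by linarith)
    linarith
  obtain hanti : AntitoneOn (fun r => lyapunov f xstar p (γ r)) (Set.Icc 0 h) := by
    refine antitoneOn_of_deriv_nonpos (convex_Icc 0 h)
      (fun t ht => ?_) (fun t ht => ?_) (fun t ht => ?_)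
    · obtain ⟨D, _, hD⟩ := key t ht
      exact hD.continuousAt.continuousWithinAt
    · obtain ⟨D, _, hD⟩ := key t (interior_subset ht)
      exact hD.differentiableAt.differentiableWithinAt
    · obtain ⟨D, hD0, hD⟩ := key t (interior_subset ht)
      rw [hD.deriv]
      exact hD0
  exact hanti ⟨le_rfl, hh⟩ ⟨hh, le_rfl⟩ hh

end Energy

/-! ### Energy increase in one step. -/

/-- Consistency makes the time component exact, so the numerical and exact states are compared at
equal times. -/
theorem RungeKutta.step_snd_snd {S d : ℕ} (rk : RungeKutta S) (hb : ∑ i, rk.b i = 1)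
    (f : EuclideanSpace ℝ (Fin d) → ℝ) (p : ℕ) (h : ℝ) (y : PhaseState d) :
    (rk.step (dynamics f p) h y).2.2 = y.2.2 + h := by
  simp [step, Prod.snd_sum, dynamics, hb]

/-- Lipschitz estimate for the Lyapunov function at equal times, in scaled coordinates. -/
theorem lyapunov_sub_le {d : ℕ} {f : EuclideanSpace ℝ (Fin d) → ℝ}
    {xstar : EuclideanSpace ℝ (Fin d)} {p : ℕ} (hp : 2 ≤ p) {τ A B δ : ℝ} (hτ : 1 ≤ τ)
    (hA : 1 ≤ A) (hB : 1 ≤ B) (hf : Differentiable ℝ f) {K : Set (EuclideanSpace ℝ (Fin d))}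
    (hK : Convex ℝ K) (hfK : ∀ x ∈ K, τ ^ p * ‖fderiv ℝ f x‖ ≤ τ * (A * (3 * B)))
    {z z' : PhaseState d} (hzz : ‖z - z'‖ ≤ δ) (ht : z.2.2 = z'.2.2) (ht0 : 0 ≤ z'.2.2)
    (htτ : z'.2.2 ≤ 2 * τ) (hw : ‖z.1‖ ≤ 3 * p * B) (hw' : ‖z'.1‖ ≤ 3 * p * B)
    (hx : ‖(τ * A)⁻¹ • z.2.1 - xstar‖ ≤ 3 * B) (hx' : ‖(τ * A)⁻¹ • z'.2.1 - xstar‖ ≤ 3 * B)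
    (hzK : (τ * A)⁻¹ • z.2.1 ∈ K) (hzK' : (τ * A)⁻¹ • z'.2.1 ∈ K) :
    lyapunov f xstar p (unscale τ A z) - lyapunov f xstar p (unscale τ A z') ≤
      (30 + 3 * 2 ^ p) * B * δ := by
  obtain ⟨w, ξ, t⟩ := z
  obtain ⟨w', ξ', t'⟩ := z'
  simp only at ht ht0 htτ hw hw' hx hx' hzK hzK'
  subst ht
  have hτ0 : 0 < τ := by linarith
  have hp' : (2 : ℝ) ≤ p := by exact_mod_cast hp
  have hδw : ‖w - w'‖ ≤ δ := (norm_fst_le _).trans hzz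
  have hδξ : ‖ξ - ξ'‖ ≤ δ := (norm_fst_le _).trans ((norm_snd_le _).trans hzz)
  have hδ : 0 ≤ δ := (norm_nonneg _).trans hδw
  have hτA : (τ * A)⁻¹ ≤ 1 := inv_le_one_of_one_le₀ (one_le_mul_of_one_le_of_one_le hτ hA)
  have hδx : ‖(τ * A)⁻¹ • ξ - (τ * A)⁻¹ • ξ'‖ ≤ (τ * A)⁻¹ * δ := by
    rw [← smul_sub, norm_smul, Real.norm_of_nonneg (by positivity)]
    gcongr
  have hδB : 0 ≤ B * δ := by positivity
  simp only [lyapunov, unscale, LinearMap.coe_mk, AddHom.coe_mk]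
  set x := (τ * A)⁻¹ • ξ
  set x' := (τ * A)⁻¹ • ξ'
  have hr : t / τ ≤ 2 := by rwa [div_le_iff₀ hτ0]
  have hr0 : 0 ≤ t / τ := by positivity
  have T1 : t ^ 2 / (4 * p ^ 2) * ‖τ⁻¹ • w‖ ^ 2 - t ^ 2 / (4 * p ^ 2) * ‖τ⁻¹ • w'‖ ^ 2 ≤
      6 * B * δ := by
    rw [norm_smul, norm_smul, Real.norm_of_nonneg (by positivity : (0 : ℝ) ≤ τ⁻¹)]
    have e : t ^ 2 / (4 * (p : ℝ) ^ 2) * (τ⁻¹ * ‖w‖) ^ 2 -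
        t ^ 2 / (4 * p ^ 2) * (τ⁻¹ * ‖w'‖) ^ 2 =
        (t / τ) ^ 2 / (4 * p ^ 2) * ((‖w‖ - ‖w'‖) * (‖w‖ + ‖w'‖)) := by
      field_simp
      ring
    rw [e]
    have h1 : ‖w‖ - ‖w'‖ ≤ δ := (norm_sub_norm_le _ _).trans hδw
    calc _ ≤ 2 ^ 2 / (4 * (p : ℝ) ^ 2) * (δ * (3 * p * B + 3 * p * B)) := by
          have : (‖w‖ - ‖w'‖) * (‖w‖ + ‖w'‖) ≤ δ * (3 * p * B + 3 * p * B) := by gcongr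
          have h0 : 0 ≤ δ * (3 * p * B + 3 * p * B) := by positivity
          calc _ ≤ (t / τ) ^ 2 / (4 * (p : ℝ) ^ 2) * (δ * (3 * p * B + 3 * p * B)) := by gcongr
            _ ≤ _ := by gcongr
      _ = 6 * B * δ / p := by
          field_simp
          ring
      _ ≤ 6 * B * δ := div_le_self (by positivity) (by linarith)
  have hc : t / (2 * p) * τ⁻¹ ≤ 1 / p := by
    have : t / (2 * p) * τ⁻¹ = (t / τ) / 2 / p := by field_simp
    rw [this]
    gcongr
    linarith
  have hc0 : 0 ≤ t / (2 * p) * τ⁻¹ := by positivity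
  have hp1 : 1 / (p : ℝ) ≤ 1 := by
    rw [div_le_one (by linarith)]
    linarith
  have ha : ∀ (u : EuclideanSpace ℝ (Fin d)) (a : EuclideanSpace ℝ (Fin d)),
      ‖u‖ ≤ 3 * p * B → ‖a - xstar‖ ≤ 3 * B →
      ‖a + (t / (2 * (p : ℝ))) • τ⁻¹ • u - xstar‖ ≤ 6 * B := by
    intro u a hu ha
    calc ‖a + (t / (2 * (p : ℝ))) • τ⁻¹ • u - xstar‖
        = ‖(a - xstar) + (t / (2 * (p : ℝ)) * τ⁻¹) • u‖ := by
          rw [smul_smul]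
          congr 1
          abel
      _ ≤ 3 * B + 1 / p * (3 * p * B) := by
          refine (norm_add_le _ _).trans (add_le_add ha ?_)
          rw [norm_smul, Real.norm_of_nonneg hc0]
          gcongr
      _ = 6 * B := by
          field_simp
          ring
  have T2 : ‖x + (t / (2 * (p : ℝ))) • τ⁻¹ • w - xstar‖ ^ 2 -
      ‖x' + (t / (2 * (p : ℝ))) • τ⁻¹ • w' - xstar‖ ^ 2 ≤ 24 * B * δ := by
    have h1 := ha w x hw hx
    have h2 := ha w' x' hw' hx'
    have h3 : ‖x + (t / (2 * (p : ℝ))) • τ⁻¹ • w - xstar‖ -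
        ‖x' + (t / (2 * (p : ℝ))) • τ⁻¹ • w' - xstar‖ ≤ 2 * δ := by
      refine (norm_sub_norm_le _ _).trans ?_
      calc _ = ‖(x - x') + (t / (2 * (p : ℝ)) * τ⁻¹) • (w - w')‖ := by
            congr 1
            module
        _ ≤ 1 * δ + 1 * δ := by
            refine (norm_add_le _ _).trans (add_le_add (hδx.trans (by gcongr)) ?_)
            rw [norm_smul, Real.norm_of_nonneg hc0]
            gcongr
            exact hc.trans hp1
        _ = 2 * δ := by ring
    rw [sq_sub_sq]
    calc _ ≤ (6 * B + 6 * B) * (2 * δ) :=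
          (mul_le_mul_of_nonneg_left h3 (by positivity)).trans (by gcongr)
      _ = 24 * B * δ := by ring
  -- The gradient bound 3τAB/τ^p meets a displacement δ/(τA), and t ≤ 2τ leaves only 2^p.
  have T3 : t ^ p * (f x - f xstar) - t ^ p * (f x' - f xstar) ≤ 3 * 2 ^ p * B * δ := by
    have h1 : ‖f x - f x'‖ ≤ (τ * (A * (3 * B)) / τ ^ p) * ‖x - x'‖ :=
      hK.norm_image_sub_le_of_norm_fderiv_le (𝕜 := ℝ) (fun a _ => hf a) (fun a haK => by
        rw [le_div_iff₀ (by positivity), mul_comm]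
        exact hfK a haK) hzK' hzK
    calc _ = t ^ p * (f x - f x') := by ring
      _ ≤ (2 * τ) ^ p * ((τ * (A * (3 * B)) / τ ^ p) * ((τ * A)⁻¹ * δ)) := by
          have h2 : f x - f x' ≤ (τ * (A * (3 * B)) / τ ^ p) * ((τ * A)⁻¹ * δ) :=
            (le_abs_self _).trans (h1.trans (by gcongr))
          calc _ ≤ t ^ p * ((τ * (A * (3 * B)) / τ ^ p) * ((τ * A)⁻¹ * δ)) := by gcongr
            _ ≤ _ := by gcongr
      _ = 3 * 2 ^ p * B * δ := by
          rw [mul_pow]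
          field_simp
  linarith

/-- One step of a Runge-Kutta method of order `s` increases the Lyapunov function by at most
`O(h ^ (s + 1))`, with the dependence on all parameters made explicit. -/
theorem RungeKutta.HasOrder.exists_lyapunov_step_le {S p s : ℕ} {rk : RungeKutta S}
    (hrk : rk.HasOrder s) (hp : 2 ≤ p) (hs : 1 ≤ s) : ∃ c > 0, ∃ C > 0,
    ∀ (d : ℕ) (f : EuclideanSpace ℝ (Fin d) → ℝ) (xstar : EuclideanSpace ℝ (Fin d)) (L M h : ℝ)
      (y : PhaseState d), ConvexOn ℝ Set.univ f → (∀ x, f xstar ≤ f x) → 0 < L → 0 ≤ M →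
      ContDiff ℝ (s + 2) f → 1 ≤ y.2.2 →
      GrowthCondition f xstar (Metric.closedBall y.2.1 1) p L →
      (∀ x ∈ Metric.closedBall y.2.1 1, ∀ i : ℕ, p ≤ i → i ≤ s + 2 →
        ‖iteratedFDeriv ℝ i f x‖ ≤ M) →
      0 < h → h * ((L + M + 1) * (lyapunov f xstar p y + 1)) ≤ c →
      lyapunov f xstar p (rk.step (dynamics f p) h y) ≤ lyapunov f xstar p y +
        C * (lyapunov f xstar p y + 1) *
          (h * ((L + M + 1) * (lyapunov f xstar p y + 1))) ^ (s + 1) := by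
  obtain ⟨c, hc, C, hC, hloc⟩ := hrk.exists_local_error
  obtain ⟨K, hK, hbound⟩ := exists_scaledDynamics_bound p (s + 1) hp
  -- The local error estimate is applied with Q = K·A·B; 30 + 3·2^p is the Lipschitz factor of the
  -- energy.
  refine ⟨c / K, by positivity, (30 + 3 * 2 ^ p) * (C * K ^ (s + 1)), by positivity, ?_⟩
  intro d f xstar L M h y hconv hmin hL hM hf hτ hgrow hbd hh hhc
  obtain ⟨v, x, τ⟩ := y
  simp only at hτ hgrow hbd
  set En := lyapunov f xstar p (v, x, τ) with hEn
  set A := L + M + 1 with hAdef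
  set B := En + 1 with hBdef
  have hτ0 : 0 < τ := by linarith
  have hE0 : 0 ≤ En := lyapunov_nonneg hmin hτ0.le
  have hA : 1 ≤ A := by linarith
  have hB : 1 ≤ B := by linarith
  have hp' : (2 : ℝ) ≤ p := by exact_mod_cast hp
  have hτA : 1 ≤ τ * A := one_le_mul_of_one_le_of_one_le hτ hA
  have hd : Differentiable ℝ f := hf.differentiable (by simp)
  -- size of the current state
  have hgap : ∀ x, 0 ≤ f x - f xstar := fun x => sub_nonneg.2 (hmin x)
  have hEn' : En = τ ^ 2 / (4 * (p : ℝ) ^ 2) * ‖v‖ ^ 2 + ‖x + (τ / (2 * (p : ℝ))) • v - xstar‖ ^ 2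
      + τ ^ p * (f x - f xstar) := rfl
  have hE1 : 0 ≤ τ ^ 2 / (4 * (p : ℝ) ^ 2) * ‖v‖ ^ 2 := by positivity
  have hE2 : 0 ≤ ‖x + (τ / (2 * (p : ℝ))) • v - xstar‖ ^ 2 := by positivity
  have hE3 : 0 ≤ τ ^ p * (f x - f xstar) := mul_nonneg (by positivity) (hgap x)
  have hv : ‖τ • v‖ ≤ 2 * p * B := by
    rw [norm_smul, Real.norm_of_nonneg hτ0.le]
    -- Each energy term is at most E ≤ B ≤ B², which avoids square roots.
    have h1 : (τ * ‖v‖ / (2 * p)) ^ 2 ≤ B ^ 2 := by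
      have : (τ * ‖v‖ / (2 * p)) ^ 2 = τ ^ 2 / (4 * (p : ℝ) ^ 2) * ‖v‖ ^ 2 := by
        field_simp
        ring
      rw [this]
      nlinarith
    have h2 := abs_le_of_sq_le_sq' h1 (by linarith)
    have h3 := h2.2
    rw [div_le_iff₀ (by positivity)] at h3
    linarith
  have hxs : ‖x - xstar‖ ≤ 2 * B := by
    have h1 : ‖x + (τ / (2 * (p : ℝ))) • v - xstar‖ ≤ B :=
      (abs_le_of_sq_le_sq' (by nlinarith) (by linarith)).2
    have h2 : ‖(τ / (2 * (p : ℝ))) • v‖ ≤ B := by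
      have : (τ / (2 * (p : ℝ))) • v = (2 * (p : ℝ))⁻¹ • τ • v := by
        rw [smul_smul]
        congr 1
        ring
      rw [this, norm_smul, Real.norm_of_nonneg (by positivity), inv_mul_le_iff₀ (by positivity)]
      exact hv
    calc ‖x - xstar‖ = ‖(x + (τ / (2 * (p : ℝ))) • v - xstar) - (τ / (2 * (p : ℝ))) • v‖ := by
          congr 1
          abel
      _ ≤ 2 * B := (norm_sub_le _ _).trans (by linarith)
  -- the scaled initial state and the points of the ball around it
  set z0 : PhaseState d := (τ • v, (τ * A) • x, τ) with hz0
  have hun : unscale τ A z0 = (v, x, τ) := by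
    simp only [unscale, hz0, LinearMap.coe_mk, AddHom.coe_mk]
    rw [inv_smul_smul₀ hτ0.ne', inv_smul_smul₀ (by positivity)]
  have hdyn := dynamics_unscale f p hτ0.ne' (by linarith : A ≠ 0)
  have hderiv : ∀ a ∈ Metric.closedBall x 1, ∀ i, 1 ≤ i → i ≤ s + 2 →
      τ ^ p * ‖iteratedFDeriv ℝ i f a‖ ≤ τ ^ i * (A * (τ ^ p * (f a - f xstar) + 1)) :=
    fun a ha i hi1 hi => pow_mul_norm_iteratedFDeriv_le hL hM (hgap a) hτ
      (fun i hi1 hi => hgrow a ha i hi1 hi) (hbd a ha) hi1 hi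
  have hfder : ∀ a ∈ Metric.closedBall x 1,
      τ ^ p * ‖fderiv ℝ f a‖ ≤ τ * A * (τ ^ p * (f a - f xstar) + 1) := by
    intro a ha
    have := hderiv a ha 1 le_rfl (by omega)
    rwa [norm_iteratedFDeriv_one, pow_one, ← mul_assoc] at this
  -- On this ball τ^p(f − f*) + 1 grows by a factor at most e ≤ 3, and it contains the positions of
  -- the scaled ball of radius 1/2.
  set N : Set (EuclideanSpace ℝ (Fin d)) := Metric.closedBall x (τ * A)⁻¹ with hN
  have hN1 : N ⊆ Metric.closedBall x 1 :=
    Metric.closedBall_subset_closedBall (inv_le_one_of_one_le₀ hτA)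
  have hNB : ∀ a ∈ N, τ ^ p * (f a - f xstar) + 1 ≤ 3 * B := by
    intro a ha
    have h1 := growth_le_exp_mul (c := τ ^ p) (by positivity) hmin hd hfder (hN1 ha) (by
      rw [hN, mem_closedBall_iff_norm] at ha
      calc τ * A * ‖a - x‖ ≤ τ * A * (τ * A)⁻¹ := by gcongr
        _ = 1 := mul_inv_cancel₀ (by positivity))
    have h2 : Real.exp 1 ≤ 3 := by linarith [Real.exp_one_lt_d9]
    calc _ ≤ _ := h1
      _ ≤ 3 * B := by
          gcongr
          linarith
  have hNder : ∀ a ∈ N, ∀ i, 1 ≤ i → i ≤ s + 2 →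
      τ ^ p * ‖iteratedFDeriv ℝ i f a‖ ≤ τ ^ i * (A * (3 * B)) := by
    intro a ha i hi1 hi
    refine (hderiv a (hN1 ha) i hi1 hi).trans ?_
    have := hNB a ha
    gcongr
  have hball : ∀ z ∈ Metric.ball z0 (1 / 2), 1 / 2 ≤ z.2.2 ∧ z.2.2 ≤ 2 * τ ∧
      ‖z.1‖ ≤ 3 * p * B ∧ (τ * A)⁻¹ • z.2.1 ∈ N ∧ ‖(τ * A)⁻¹ • z.2.1 - xstar‖ ≤ 3 * B := by
    intro z hz
    rw [mem_ball_iff_norm] at hz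
    have h1 : ‖z.1 - τ • v‖ < 1 / 2 := (norm_fst_le (z - z0)).trans_lt hz
    have h2 : ‖z.2.1 - (τ * A) • x‖ < 1 / 2 :=
      (norm_fst_le (z - z0).2).trans_lt ((norm_snd_le (z - z0)).trans_lt hz)
    have h3 : |z.2.2 - τ| < 1 / 2 :=
      (norm_snd_le (z - z0).2).trans_lt ((norm_snd_le (z - z0)).trans_lt hz)
    rw [abs_lt] at h3
    have h4 : ‖(τ * A)⁻¹ • z.2.1 - x‖ ≤ (τ * A)⁻¹ := by
      have : (τ * A)⁻¹ • z.2.1 - x = (τ * A)⁻¹ • (z.2.1 - (τ * A) • x) := by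
        rw [smul_sub, inv_smul_smul₀ (by positivity)]
      rw [this, norm_smul, Real.norm_of_nonneg (by positivity)]
      exact mul_le_of_le_one_right (by positivity) (by linarith)
    have h5 : (τ * A)⁻¹ ≤ 1 := inv_le_one_of_one_le₀ hτA
    refine ⟨by linarith, by linarith, ?_, mem_closedBall_iff_norm.2 h4, ?_⟩
    · have := norm_le_norm_add_norm_sub' z.1 (τ • v)
      have hpB : 1 ≤ p * B := one_le_mul_of_one_le_of_one_le (by linarith) hB
      linarith
    · have : (τ * A)⁻¹ • z.2.1 - xstar = ((τ * A)⁻¹ • z.2.1 - x) + (x - xstar) := by abel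
      rw [this]
      refine (norm_add_le _ _).trans ?_
      linarith
  -- the local error
  have hfn : ContDiff ℝ ((s + 1 : ℕ) + 1) f := by
    have e : (((s + 1 : ℕ) : WithTop ℕ∞) + 1) = s + 2 := by
      push_cast
      rw [add_assoc, one_add_one_eq_two]
    rwa [e]
  obtain ⟨hstep, γ, hγ0, hγ, herr⟩ := hloc (PhaseState d) (scaledDynamics f p τ A) z0
    (K * (A * B)) (by positivity)
    (fun z hz => by
      have h1 := (contDiffOn_scaledDynamics (p := p) (τ := τ) (A := A) hfn).contDiffAt
        ((isOpen_lt continuous_const (by fun_prop)).mem_nhds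
          (show (0 : ℝ) < z.2.2 by linarith [(hball z hz).1]))
      exact_mod_cast h1)
    (fun z hz i hi => hbound d f τ A B z hfn hτ hA hB (hball z hz).1 (hball z hz).2.1
      (hball z hz).2.2.1 (fun j hj1 hj => hNder _ (hball z hz).2.2.2.1 j hj1 (by omega)) i hi)
    h hh (by
      rw [le_div_iff₀ hK] at hhc
      calc h * (K * (A * B)) = h * (A * B) * K := by ring
        _ ≤ c := hhc)
  set U : PhaseState d →L[ℝ] PhaseState d := (unscale τ A).toContinuousLinearMap with hU
  have hγy : ∀ t ∈ Set.Icc 0 h,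
      HasDerivAt (fun r => unscale τ A (γ r)) (dynamics f p (unscale τ A (γ t))) t := by
    intro t ht
    rw [hdyn]
    exact U.hasFDerivAt.comp_hasDerivAt t (hγ t ht).2
  have hmono := lyapunov_le_of_integralCurve (xstar := xstar) hp hconv hd hh.le hγy
    (fun t ht => lt_of_lt_of_le (by norm_num) (hball _ (hγ t ht).1).1)
  rw [hγ0, hun] at hmono
  have hstepeq : rk.step (dynamics f p) h (v, x, τ) =
      unscale τ A (rk.step (scaledDynamics f p τ A) h z0) := by
    rw [← hun]
    exact rk.step_map (unscale τ A) hdyn h z0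
  have htime : (rk.step (scaledDynamics f p τ A) h z0).2.2 = (γ h).2.2 := by
    have h1 : (rk.step (scaledDynamics f p τ A) h z0).2.2 = τ + h := by
      have := congrArg (fun z : PhaseState d => z.2.2) hstepeq
      rw [rk.step_snd_snd (hrk.sum_b_eq_one hs)] at this
      exact this.symm
    have h2 : ∀ t ∈ Set.Icc 0 h, HasDerivAt (fun r => (γ r).2.2 - r) 0 t := by
      intro t ht
      have h3 : HasDerivAt (fun r => (γ r).2.2) 1 t := (hγ t ht).2.snd.snd
      exact (h3.sub (hasDerivAt_id t)).congr_deriv (sub_self 1)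
    have h3 := constant_of_has_deriv_right_zero
      (fun t ht => (h2 t ht).continuousAt.continuousWithinAt)
      (fun t ht => (h2 t (Set.Ico_subset_Icc_self ht)).hasDerivWithinAt) h ⟨hh.le, le_rfl⟩
    rw [hγ0] at h3
    simp only [hz0] at h3
    rw [h1]
    linarith
  have hz1 := hball _ hstep
  have hz2 := hball _ (hγ h ⟨hh.le, le_rfl⟩).1
  have hlip := lyapunov_sub_le (xstar := xstar) hp hτ hA hB hd (convex_closedBall x (τ * A)⁻¹)
    (fun a ha => by
      have := hNder a ha 1 le_rfl (by omega)
      rwa [norm_iteratedFDeriv_one, pow_one] at this)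
    herr htime (by linarith [hz2.1]) hz2.2.1 hz1.2.2.1 hz2.2.2.1 hz1.2.2.2.2 hz2.2.2.2.2
    hz1.2.2.2.1 hz2.2.2.2.1
  rw [hstepeq]
  have efin : (30 + 3 * 2 ^ p) * B * (C * (h * (K * (A * B))) ^ (s + 1)) =
      (30 + 3 * 2 ^ p) * (C * K ^ (s + 1)) * B * (h * (A * B)) ^ (s + 1) := by
    rw [mul_left_comm h K, mul_pow]
    ring
  linarith

/-! ### Iteration over N steps. -/

theorem lyapunov_initial {d : ℕ} (f : EuclideanSpace ℝ (Fin d) → ℝ)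
    (xstar x0 : EuclideanSpace ℝ (Fin d)) (p : ℕ) :
    lyapunov f xstar p (0, x0, 1) = f x0 - f xstar + ‖x0 - xstar‖ ^ 2 := by
  simp [lyapunov, add_comm]

/-- `(1 + 1/(2N))^k ≤ 1 + k/N` for `k ≤ N`. -/
theorem one_add_half_inv_pow_le {N k : ℕ} (hk : k ≤ N) :
    (1 + 1 / (2 * (N : ℝ))) ^ k ≤ 1 + (k : ℝ) / N := by
  induction k with
  | zero => simp
  | succ k ih =>
    have hN : (0 : ℝ) < N := by
      have : 0 < N := by omega
      exact_mod_cast this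
    have hkN : (k : ℝ) / N ≤ 1 := by
      rw [div_le_one hN]
      exact_mod_cast (by omega : k ≤ N)
    rw [pow_succ]
    calc _ ≤ (1 + (k : ℝ) / N) * (1 + 1 / (2 * (N : ℝ))) := by
          have := ih (by omega)
          gcongr
      _ = 1 + (k : ℝ) / N + (1 + (k : ℝ) / N) / 2 * (1 / N) := by
          field_simp
      _ ≤ 1 + (k : ℝ) / N + 1 * (1 / N) := by
          gcongr
          linarith
      _ = _ := by
          push_cast
          ring

theorem one_add_inv_pow_le_exp {N k : ℕ} (hk : k ≤ N) :
    (1 + 1 / (N : ℝ)) ^ k ≤ Real.exp 1 := by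
  rcases Nat.eq_zero_or_pos N with rfl | hN
  · simp [Nat.le_zero.1 hk]
  have hN' : (N : ℝ) ≠ 0 := by exact_mod_cast hN.ne'
  calc (1 + 1 / (N : ℝ)) ^ k ≤ (1 + 1 / (N : ℝ)) ^ N :=
        pow_le_pow_right₀ (le_add_of_nonneg_right (by positivity)) hk
    _ ≤ Real.exp (1 / N) ^ N := by
        gcongr
        linarith [Real.add_one_le_exp (1 / (N : ℝ))]
    _ = Real.exp 1 := by
        rw [← Real.exp_nat_mul, mul_one_div_cancel hN']

/-- A sequence growing by the factor `1 + 1/(2N)`, up to a unit shift, grows at most as claimed. -/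
theorem le_of_add_one_le_pow {N k : ℕ} (hk : k ≤ N) {E E0 : ℝ} (hE0 : 0 ≤ E0)
    (h : E + 1 ≤ (1 + 1 / (2 * (N : ℝ))) ^ k * (E0 + 1)) :
    -- With a = 1 + 1/(2N), the hypothesis reads E ≤ a^k·E0 + (a^k − 1); the two summands are
    -- bounded separately by `h2` and `h1`.
    E ≤ (1 + 1 / (N : ℝ)) ^ k * E0 + (k : ℝ) / N := by
  have h1 := one_add_half_inv_pow_le hk
  have h2 : (1 + 1 / (2 * (N : ℝ))) ^ k ≤ (1 + 1 / (N : ℝ)) ^ k := by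
    have : 1 / (2 * (N : ℝ)) ≤ 1 / N := by
      rw [one_div, mul_inv, one_div]
      have : 0 ≤ (N : ℝ)⁻¹ := by positivity
      linarith
    gcongr
  have h3 := mul_le_mul_of_nonneg_right h2 hE0
  linarith

/-- Besides the final claim, this keeps every iterate in the sublevel set during the induction. -/
theorem le_exp_mul_add_one {N k : ℕ} (hk : k ≤ N) {E E0 : ℝ} (hE0 : 0 ≤ E0)
    (h : E ≤ (1 + 1 / (N : ℝ)) ^ k * E0 + (k : ℝ) / N) : E ≤ Real.exp 1 * E0 + 1 := by
  have h1 := mul_le_mul_of_nonneg_right (one_add_inv_pow_le_exp hk) hE0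
  have h2 : (k : ℝ) / N ≤ 1 := div_le_one_of_le₀ (by exact_mod_cast hk) (by positivity)
  linarith

theorem mainTheorem1 {S : ℕ} (rk : RungeKutta S) (p s : ℕ) (hp : 2 ≤ p) (hs : 1 ≤ s)
    (hps : p ≤ s + 2) (hrk : rk.HasOrder s) :
    ∃ C : ℝ, 0 < C ∧
      ∀ (d : ℕ) (f : EuclideanSpace ℝ (Fin d) → ℝ) (xstar x0 : EuclideanSpace ℝ (Fin d))
        (L M : ℝ) (N : ℕ) (h : ℝ),
        ConvexOn ℝ Set.univ f →
        (∀ x, f xstar ≤ f x) →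
        0 < L → 0 ≤ M →
        GrowthCondition f xstar (neighborhoodA f xstar x0) p L →
        DerivativeBound f (neighborhoodA f xstar x0) p s M →
        1 ≤ N → 0 < h →
        h ≤ C * (N : ℝ) ^ (-(1 : ℝ) / ((s : ℝ) + 1)) /
          ((L + M + 1) *
            (Real.exp 1 * lyapunov f xstar p (rkIterate rk f p x0 h 0) + 1)) →
        (∀ k : ℕ, k ≤ N →
          lyapunov f xstar p (rkIterate rk f p x0 h k) ≤
            (1 + 1 / (N : ℝ)) ^ k * lyapunov f xstar p (rkIterate rk f p x0 h 0)
              + (k : ℝ) / (N : ℝ)) ∧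
        lyapunov f xstar p (rkIterate rk f p x0 h N) ≤
          Real.exp 1 * lyapunov f xstar p (rkIterate rk f p x0 h 0) + 1 := by
  obtain ⟨c, hc, C, hC, hstep⟩ := hrk.exists_lyapunov_step_le hp hs
  -- The factor 2C' arises from E_k + 1 ≤ 2(eE_0 + 1). The three entries ensure the smallness needed
  -- for a step, (2C')^(s+1) ≤ 2C', and C·2C' ≤ 1/2.
  set C' : ℝ := min (c / 2) (min (1 / 2) (1 / (4 * C))) with hC'
  have hC'0 : 0 < C' := by positivity
  have hC'c : 2 * C' ≤ c := by linarith [min_le_left (c / 2) (min (1 / 2) (1 / (4 * C)))]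
  have hC'1 : 2 * C' ≤ 1 := by
    have := (min_le_right (c / 2) (min (1 / 2) (1 / (4 * C)))).trans (min_le_left _ _)
    linarith
  have hC'C : C * (2 * C') ≤ 1 / 2 := by
    have := (min_le_right (c / 2) (min (1 / 2) (1 / (4 * C)))).trans (min_le_right _ _)
    rw [← hC', le_div_iff₀ (by positivity)] at this
    linarith
  refine ⟨C', hC'0, ?_⟩
  intro d f xstar x0 L M N h hconv hmin hL hM hgrow hbd hN hh hhC
  set En : ℕ → ℝ := fun k => lyapunov f xstar p (rkIterate rk f p x0 h k) with hEn
  have hE0 : En 0 = f x0 - f xstar + ‖x0 - xstar‖ ^ 2 := lyapunov_initial f xstar x0 p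
  have hE00 : 0 ≤ En 0 := lyapunov_nonneg hmin zero_le_one
  have hN0 : (0 : ℝ) < N := by exact_mod_cast hN
  set ν : ℝ := (N : ℝ) ^ (-(1 : ℝ) / ((s : ℝ) + 1)) with hν
  have hν0 : 0 ≤ ν := by positivity
  have hνN : ν ^ (s + 1) = 1 / N := by
    have hs1 : (s : ℝ) + 1 ≠ 0 := by positivity
    rw [hν, ← Real.rpow_natCast, ← Real.rpow_mul hN0.le]
    push_cast
    rw [div_mul_cancel₀ _ hs1, Real.rpow_neg_one, one_div]
  have hν1 : ν ≤ 1 := by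
    refine Real.rpow_le_one_of_one_le_of_nonpos (by exact_mod_cast hN) ?_
    exact div_nonpos_of_nonpos_of_nonneg (by norm_num) (by positivity)
  have hX : 0 < (L + M + 1) * (Real.exp 1 * En 0 + 1) := by positivity
  have hhX : h * ((L + M + 1) * (Real.exp 1 * En 0 + 1)) ≤ C' * ν := by
    rwa [le_div_iff₀ hX] at hhC
  -- The induction runs on E + 1, which grows by a pure factor; the time is carried along because
  -- every step needs t ≥ 1.
  have hmain : ∀ k ≤ N, (rkIterate rk f p x0 h k).2.2 = 1 + k * h ∧
      En k + 1 ≤ (1 + 1 / (2 * (N : ℝ))) ^ k * (En 0 + 1) := by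
    intro k
    induction k with
    | zero => intro _; simp [rkIterate]
    | succ k ih =>
      intro hk
      obtain ⟨htime, hEk⟩ := ih (by omega)
      have ht1 : 1 ≤ (rkIterate rk f p x0 h k).2.2 := by
        rw [htime]
        exact le_add_of_nonneg_right (by positivity)
      have hEk0 : 0 ≤ En k := lyapunov_nonneg hmin (by linarith)
      have hEke : En k ≤ Real.exp 1 * En 0 + 1 :=
        le_exp_mul_add_one (by omega) hE00 (le_of_add_one_le_pow (by omega) hE00 hEk)
      constructor
      · rw [rkIterate, rk.step_snd_snd (hrk.sum_b_eq_one hs), htime]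
        push_cast
        ring
      -- As t ≥ 1, the energy dominates f − f*, so the energy bound puts the iterate in 𝓢 and its
      -- unit ball in 𝓐.
      have hxS : (rkIterate rk f p x0 h k).2.1 ∈ sublevelS f xstar x0 := by
        change f _ - f xstar ≤ Real.exp 1 * (f x0 - f xstar + ‖x0 - xstar‖ ^ 2) + 1
        rw [← hE0]
        refine le_trans ?_ hEke
        have h1 : f (rkIterate rk f p x0 h k).2.1 - f xstar ≤
            (rkIterate rk f p x0 h k).2.2 ^ p * (f (rkIterate rk f p x0 h k).2.1 - f xstar) :=
          le_mul_of_one_le_left (sub_nonneg.2 (hmin _)) (one_le_pow₀ ht1)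
        refine h1.trans (le_add_of_nonneg_left ?_)
        positivity
      have hsub : Metric.closedBall (rkIterate rk f p x0 h k).2.1 1 ⊆ neighborhoodA f xstar x0 :=
        fun x hx => ⟨_, hxS, mem_closedBall_iff_norm.1 hx⟩
      have hsmall : h * ((L + M + 1) * (En k + 1)) ≤ 2 * C' * ν := by
        calc h * ((L + M + 1) * (En k + 1))
            ≤ h * ((L + M + 1) * (2 * (Real.exp 1 * En 0 + 1))) := by
              have : 0 ≤ Real.exp 1 * En 0 := by positivity
              gcongr
              linarith
          _ = 2 * (h * ((L + M + 1) * (Real.exp 1 * En 0 + 1))) := by ring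
          _ ≤ 2 * C' * ν := by linarith
      have key := hstep d f xstar L M h (rkIterate rk f p x0 h k) hconv hmin hL hM hbd.1 ht1
        (fun x hx => hgrow x (hsub hx)) (fun x hx => hbd.2 x (hsub hx)) hh
        (hsmall.trans ((mul_le_of_le_one_right (by positivity) hν1).trans hC'c))
      have hpow : C * (h * ((L + M + 1) * (En k + 1))) ^ (s + 1) ≤ 1 / (2 * (N : ℝ)) := by
        calc C * (h * ((L + M + 1) * (En k + 1))) ^ (s + 1) ≤ C * (2 * C' * ν) ^ (s + 1) := by
              gcongr
          _ = C * (2 * C') ^ (s + 1) * (1 / N) := by rw [mul_pow, hνN, mul_assoc]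
          _ ≤ C * (2 * C') * (1 / N) := by
              gcongr
              exact pow_le_of_le_one (by positivity) hC'1 (by omega)
          _ ≤ 1 / 2 * (1 / N) := by gcongr
          _ = 1 / (2 * (N : ℝ)) := by field_simp
      have hnext : En (k + 1) ≤ En k + (En k + 1) * (1 / (2 * (N : ℝ))) := by
        refine key.trans ?_
        change En k + C * (En k + 1) * (h * ((L + M + 1) * (En k + 1))) ^ (s + 1) ≤ _
        rw [mul_comm C, mul_assoc]
        gcongr
      calc En (k + 1) + 1 ≤ (1 + 1 / (2 * (N : ℝ))) * (En k + 1) := by linarith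
        _ ≤ (1 + 1 / (2 * (N : ℝ))) * ((1 + 1 / (2 * (N : ℝ))) ^ k * (En 0 + 1)) := by gcongr
        _ = _ := by rw [pow_succ']; ring
  have hfin : ∀ k ≤ N, En k ≤ (1 + 1 / (N : ℝ)) ^ k * En 0 + (k : ℝ) / N := fun k hk =>
    le_of_add_one_le_pow hk hE00 (hmain k hk).2
  exact ⟨hfin, le_exp_mul_add_one le_rfl hE00 (hfin N le_rfl)⟩
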